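/- **Definitions.** The rudimentary functions (from $n$-tuples of sets to sets) are the functions generated from $F(x_1,\dots,x_n)=x_i$, $F(x_1,\dots,x_n)=\{x_i,x_j\}$ and $F(x_1,\dots,x_n)=x_i\setminus x_j$ by composition and by the scheme $F(x_1,\dots,x_n)=\bigcup_{y\in x_1}H(y,x_2,\dots,x_n)$. The rudimentary closure of a set $x$ is the smallest set $y$ with $x\subseteq y$, $x\in y$ that is closed under all rudimentary functions; $J_1$ is the rudimentary closure of $J_0=\emptyset$ and $J_2$ is the rudimentary closure of $J_1$. A definable subset of a set $x$ is a set $\{y\in x:\phi^x(y,x_1,\dots,x_k)\}$ with $x_1,\dots,x_k\in x$ and $\phi$ a first-order formula in the symbols $\in,\subseteq,=$ whose quantifiers range over $x$. An *$\iota$-set* is an element of $J_2$. An *$\iota$-class* is a definable subset of $J_2$ whose intersection with every $\iota$-set is an $\iota$-set. An *$\iota$-relation* on an $\iota$-class $X$ is an $\iota$-class contained in $X\times X$ (with ordered pairs $\langle a,b\rangle=\{\{a\},\{a,b\}\}$); an *equivalence $\iota$-relation* is an $\iota$-relation that is an equivalence relation on $X$. A *universal well-ordering* is an $\iota$-relation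 $\preceq_{\mathcal U}$ on $J_2$ that well-orders $J_2$ in such a way that each proper initial segment is an $\iota$-set and each $\iota$-set is contained in a proper initial segment. Given a universal well-ordering $\preceq_{\mathcal U}$ and an equivalence $\iota$-relation $\sim$ on an $\iota$-class $X$, the *quotient* is $$X/{\sim}=\{a\in X:\ (\forall b)[(b\in X\wedge a\sim b)\Rightarrow a\preceq_{\mathcal U}b]\}.$$ **Proposition.** A universal well-ordering $\preceq_{\mathcal U}$ of $J_2$ exists, and for every choice of $\preceq_{\mathcal U}$ the following hold. If $X$ is an $\iota$-set and $\sim$ is an equivalence $\iota$-relation on $X$, then $X/{\sim}$ is an $\iota$-set. If $X$ is an $\iota$-class and $\sim$ is an equivalence $\iota$-relation on $X$, then $X/{\sim}$ is an $\iota$-class. -/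

import Mathlib

namespace AnalysisJ2

/-! ### Rudimentary functions -/

/-- Rudimentary functions from `n`-tuples of sets to sets.  In the last clause
`Function.update x 0 y` is the tuple `(y, x₂, …, xₙ)`, so the value is
`⋃_{y ∈ x₁} H(y, x₂, …, xₙ)`. -/
inductive Rudimentary : {n : ℕ} → ((Fin n → ZFSet.{0}) → ZFSet.{0}) → Prop
  | proj {n : ℕ} (i : Fin n) : Rudimentary (fun x => x i)
  | pair {n : ℕ} (i j : Fin n) : Rudimentary (fun x => {x i, x j})
  | diff {n : ℕ} (i j : Fin n) : Rudimentary (fun x => x i \ x j)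
  | comp {n k : ℕ} {G : (Fin k → ZFSet.{0}) → ZFSet.{0}}
      {H : Fin k → (Fin n → ZFSet.{0}) → ZFSet.{0}}
      (hG : Rudimentary G) (hH : ∀ i, Rudimentary (H i)) :
      Rudimentary (fun x => G (fun i => H i x))
  | union {n : ℕ} {H : (Fin (n + 1) → ZFSet.{0}) → ZFSet.{0}} (hH : Rudimentary H) :
      Rudimentary (fun x : Fin (n + 1) → ZFSet.{0} =>
        ZFSet.iUnion (fun y : x 0 => H (Function.update x 0 y)))

/-- `y` is closed under application of all rudimentary functions. -/
def RudClosed (y : ZFSet.{0}) : Prop :=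
  ∀ ⦃n : ℕ⦄ ⦃F : (Fin n → ZFSet.{0}) → ZFSet.{0}⦄, Rudimentary F →
    ∀ v : Fin n → ZFSet.{0}, (∀ i, v i ∈ y) → F v ∈ y

/-- The sets generated from the elements of `x` and `x` itself by rudimentary functions. -/
inductive RudGenerated (x : ZFSet.{0}) : ZFSet.{0} → Prop
  | mem {z : ZFSet.{0}} (hz : z ∈ x) : RudGenerated x z
  | self : RudGenerated x x
  | app {n : ℕ} {F : (Fin n → ZFSet.{0}) → ZFSet.{0}} (hF : Rudimentary F)
      (v : Fin n → ZFSet.{0}) (hv : ∀ i, RudGenerated x (v i)) : RudGenerated x (F v)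

/-! Codes, used only to see that the sets in `RudGenerated x` are few enough to form a set. -/

/-- Codes for rudimentary functions. -/
inductive RudCode : ℕ → Type
  | proj {n : ℕ} (i : Fin n) : RudCode n
  | pair {n : ℕ} (i j : Fin n) : RudCode n
  | diff {n : ℕ} (i j : Fin n) : RudCode n
  | comp {n k : ℕ} (g : RudCode k) (h : Fin k → RudCode n) : RudCode n
  | union {n : ℕ} (h : RudCode (n + 1)) : RudCode (n + 1)

/-- The function with a given code. -/
noncomputable def RudCode.eval : {n : ℕ} → RudCode n → (Fin n → ZFSet.{0}) → ZFSet.{0}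
  | _, .proj i => fun x => x i
  | _, .pair i j => fun x => {x i, x j}
  | _, .diff i j => fun x => x i \ x j
  | _, .comp g h => fun x => g.eval (fun i => (h i).eval x)
  | _, .union h => fun x => ZFSet.iUnion (fun y : x 0 => h.eval (Function.update x 0 y))

theorem Rudimentary.exists_code {n : ℕ} {F : (Fin n → ZFSet.{0}) → ZFSet.{0}}
    (hF : Rudimentary F) : ∃ c : RudCode n, c.eval = F := by
  induction hF with
  | proj i => exact ⟨.proj i, rfl⟩
  | pair i j => exact ⟨.pair i j, rfl⟩
  | diff i j => exact ⟨.diff i j, rfl⟩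
  | comp _ _ ihG ihH =>
    obtain ⟨g, rfl⟩ := ihG
    choose h hh using ihH
    refine ⟨.comp g h, ?_⟩
    simp only [RudCode.eval, hh]
  | union _ ih =>
    obtain ⟨h, rfl⟩ := ih
    exact ⟨.union h, rfl⟩

/-- Codes for the elements of the rudimentary closure of `x`. -/
inductive GenCode (x : ZFSet.{0}) : Type
  | mem (z : Shrink.{0} x) : GenCode x
  | self : GenCode x
  | app {n : ℕ} (c : RudCode n) (v : Fin n → GenCode x) : GenCode x

/-- The set with a given code. -/
noncomputable def GenCode.eval {x : ZFSet.{0}} : GenCode x → ZFSet.{0}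
  | .mem z => ((equivShrink x).symm z : x)
  | .self => x
  | .app c v => c.eval (fun i => (v i).eval)

theorem RudGenerated.exists_code {x z : ZFSet.{0}} (h : RudGenerated x z) :
    ∃ c : GenCode x, c.eval = z := by
  induction h with
  | mem hz => exact ⟨.mem (equivShrink x ⟨_, hz⟩), by simp [GenCode.eval]⟩
  | self => exact ⟨.self, rfl⟩
  | app hF v _ ih =>
    obtain ⟨c, rfl⟩ := hF.exists_code
    choose w hw using ih
    refine ⟨.app c w, ?_⟩
    simp only [GenCode.eval, hw]

/-- The rudimentary closure of `x`; see `isLeast_rudClosure`. -/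
noncomputable def rudClosure (x : ZFSet.{0}) : ZFSet.{0} :=
  ZFSet.sep (RudGenerated x) (ZFSet.range (GenCode.eval (x := x)))

theorem mem_rudClosure {x z : ZFSet.{0}} : z ∈ rudClosure x ↔ RudGenerated x z := by
  rw [rudClosure, ZFSet.mem_sep, ZFSet.mem_range]
  exact ⟨fun h => h.2, fun h => ⟨h.exists_code, h⟩⟩

/-- The rudimentary closure of `x` is the smallest set `y` such that `x ⊆ y`, `x ∈ y` and `y` is
closed under all rudimentary functions. -/
theorem isLeast_rudClosure (x : ZFSet.{0}) :
    IsLeast {y : ZFSet.{0} | x ⊆ y ∧ x ∈ y ∧ RudClosed y} (rudClosure x) := by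
  refine ⟨⟨fun z hz => mem_rudClosure.2 (.mem hz), mem_rudClosure.2 .self,
    fun n F hF v hv => mem_rudClosure.2 (.app hF v fun i => mem_rudClosure.1 (hv i))⟩, ?_⟩
  rintro y ⟨hsub, hmem, hcl⟩
  intro z hz
  have h := mem_rudClosure.1 hz
  clear hz
  induction h with
  | mem hz => exact hsub hz
  | self => exact hmem
  | app hF v _ ih => exact hcl hF v ih

/-- The first set of Jensen's hierarchy (`J₀ = ∅`). -/
noncomputable def J1 : ZFSet.{0} := rudClosure ∅

/-- The second set of Jensen's hierarchy. -/
noncomputable def J2 : ZFSet.{0} := rudClosure J1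

/-! ### Definable subsets -/

/-- The non-logical symbols `∈` and `⊆` of the language of set theory (equality is a logical symbol
of Mathlib's first-order formulas). -/
inductive SetRel : ℕ → Type
  | mem : SetRel 2
  | subset : SetRel 2

/-- The first-order language of set theory. -/
def setLanguage : FirstOrder.Language.{0, 0} := ⟨fun _ => Empty, SetRel⟩

/-- The symbol `∈`. -/
abbrev memSymb : setLanguage.Relations 2 := SetRel.mem

/-- The symbol `⊆`. -/
abbrev subsetSymb : setLanguage.Relations 2 := SetRel.subset

/-- A set `x` as a structure for the language of set theory: quantifiers range over the elements
of `x`, and `∈`, `⊆` have their usual meaning. -/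
instance setStructure (x : ZFSet.{0}) : setLanguage.Structure x where
  funMap := fun f => f.elim
  RelMap := fun r =>
    match r with
    | .mem => fun v => (v 0 : ZFSet.{0}) ∈ (v 1 : ZFSet.{0})
    | .subset => fun v => (v 0 : ZFSet.{0}) ⊆ (v 1 : ZFSet.{0})

/-- `Y` is a definable subset of `x`: the set of the `y ∈ x` that satisfy a first-order formula
relativized to `x`, with parameters from `x`. -/
def IsDefinableSubset (x : ZFSet.{0}) (Y : Set ZFSet.{0}) : Prop :=
  ∃ S : Set x, (Set.univ : Set x).Definable₁ setLanguage S ∧ Y = Subtype.val '' S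

/-! ### `ι`-sets, `ι`-classes, `ι`-relations -/

/-- A collection of sets is an `ι`-set if it is (the extension of) an element of `J₂`. -/
def IsIotaSet (X : Set ZFSet.{0}) : Prop :=
  ∃ x ∈ J2, (x : Set ZFSet.{0}) = X

/-- An `ι`-class is a definable subset of `J₂` whose intersection with every `ι`-set is an
`ι`-set. -/
def IsIotaClass (X : Set ZFSet.{0}) : Prop :=
  IsDefinableSubset J2 X ∧ ∀ Y : Set ZFSet.{0}, IsIotaSet Y → IsIotaSet (X ∩ Y)

/-- `R` is an `ι`-relation on `X`: an `ι`-class contained in `X × X`. -/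
def IsIotaRelation (R X : Set ZFSet.{0}) : Prop :=
  IsIotaClass R ∧ ∀ z ∈ R, ∃ a ∈ X, ∃ b ∈ X, z = ZFSet.pair a b

/-- `E` is an equivalence `ι`-relation on `X`. -/
structure IsEquivalenceIotaRelation (E X : Set ZFSet.{0}) : Prop where
  iotaRelation : IsIotaRelation E X
  refl : ∀ a ∈ X, ZFSet.pair a a ∈ E
  symm : ∀ a ∈ X, ∀ b ∈ X, ZFSet.pair a b ∈ E → ZFSet.pair b a ∈ E
  trans : ∀ a ∈ X, ∀ b ∈ X, ∀ c ∈ X,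
    ZFSet.pair a b ∈ E → ZFSet.pair b c ∈ E → ZFSet.pair a c ∈ E

/-! ### Universal well-orderings and quotients -/

/-- `W`, as a reflexive order relation, well-orders `X`. -/
structure WellOrders (W X : Set ZFSet.{0}) : Prop where
  refl : ∀ a ∈ X, ZFSet.pair a a ∈ W
  antisymm : ∀ a ∈ X, ∀ b ∈ X, ZFSet.pair a b ∈ W → ZFSet.pair b a ∈ W → a = b
  trans : ∀ a ∈ X, ∀ b ∈ X, ∀ c ∈ X,
    ZFSet.pair a b ∈ W → ZFSet.pair b c ∈ W → ZFSet.pair a c ∈ W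
  total : ∀ a ∈ X, ∀ b ∈ X, ZFSet.pair a b ∈ W ∨ ZFSet.pair b a ∈ W
  exists_least : ∀ S ⊆ X, S.Nonempty → ∃ a ∈ S, ∀ b ∈ S, ZFSet.pair a b ∈ W

/-- `S` is a (proper) initial segment of `J₂` with respect to `W`. -/
def IsInitialSegment (W S : Set ZFSet.{0}) : Prop :=
  S ⊂ (J2 : Set ZFSet.{0}) ∧ ∀ a ∈ S, ∀ b ∈ J2, ZFSet.pair b a ∈ W → b ∈ S

/-- `W` is a universal well-ordering: an `ι`-relation which well-orders `J₂` in such a way that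
each initial segment is an `ι`-set and each `ι`-set is contained in an initial segment. -/
structure IsUniversalWellOrdering (W : Set ZFSet.{0}) : Prop where
  iotaRelation : IsIotaRelation W (J2 : Set ZFSet.{0})
  wellOrders : WellOrders W (J2 : Set ZFSet.{0})
  initialSegment_isIotaSet : ∀ S : Set ZFSet.{0}, IsInitialSegment W S → IsIotaSet S
  exists_initialSegment : ∀ Y : Set ZFSet.{0}, IsIotaSet Y →
    ∃ S : Set ZFSet.{0}, IsInitialSegment W S ∧ Y ⊆ S

/-- The quotient `X / E`, formed by picking the `W`-least element of each block. -/
def quotient (W X E : Set ZFSet.{0}) : Set ZFSet.{0} :=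
  {a | a ∈ X ∧ ∀ b, b ∈ X ∧ ZFSet.pair a b ∈ E → ZFSet.pair a b ∈ W}

end AnalysisJ2

/-! Given a universal well-ordering, quotients are short work. For an ι-set `x`, the equivalence and
the ordering restrict to ι-sets `e`, `w` on `x × x`, and the quotient is `x \ dom (e \ w)`
(`isIotaSet_quotient`). For an ι-class, definability is read off the defining formula; to intersect
with an ι-set `Y`, choose an initial segment `S ⊇ Y`. Whatever precedes a member of `S` is in `S`,
so `X` may be replaced by the ι-set `X ∩ S` (`isIotaClass_quotient`).

The substance is existence. A well-ordering of a transitive set `A` is end-extended by the sets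
`B(A, x, y) ∩ A`, ordered by their lexicographically least codes `(x, y)`; here `B` is first the
constant `A`, then each of nine basic operations. The resulting `step` is rudimentary, so its
iterates over `p` stay in every rudimentarily closed set containing `p`. Conversely, the union of
the levels is closed under all rudimentary functions (`Good.rudimentary_mem_level`). An induction on
functions must handle `⋃_{y ∈ x} H(y, …)`, so it carries a stronger claim: the graph of each
function, restricted to a level, is an element of some level (`Good.localFun`). Thus the levels
exhaust a rudimentary closure (`Good.mem_rudClosure_iff`).

Membership in the union of the tower is witnessed by a chain of stages, recognised by a rudimentary
relation (`Cert`). The construction is used twice. Over `{⟨∅, ∅⟩}` it exhausts `J1`; as `J1 ∈ J2`,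
the well-ordering obtained is an element of `J2`. Over that well-ordering it exhausts `J2`, and the
union is universal: certificates make it definable, and end extension lets each ι-set see only one
stage (`Good.isUniversalWellOrdering`). -/

namespace AnalysisJ2

/-! ### A calculus of rudimentary functions and relations -/

/-- The union `⋃_{y ∈ x} H(y)`. -/
noncomputable def bUnion (x : ZFSet.{0}) (H : ZFSet.{0} → ZFSet.{0}) : ZFSet.{0} :=
  ZFSet.iUnion (fun y : x => H y)

theorem mem_bUnion {x t : ZFSet.{0}} {H : ZFSet.{0} → ZFSet.{0}} :
    t ∈ bUnion x H ↔ ∃ y ∈ x, t ∈ H y := by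
  simp [bUnion]

/-- The set `x` if `P` holds, and `∅` otherwise. -/
def guard (P : Prop) (x : ZFSet.{0}) : ZFSet.{0} := ZFSet.sep (fun _ => P) x

theorem mem_guard {P : Prop} {x t : ZFSet.{0}} : t ∈ guard P x ↔ t ∈ x ∧ P := by
  simp [guard]

/-- A relation is rudimentary if it is the non-vanishing of a rudimentary function. -/
def RudRel {n : ℕ} (P : (Fin n → ZFSet.{0}) → Prop) : Prop :=
  ∃ F : (Fin n → ZFSet.{0}) → ZFSet.{0}, Rudimentary F ∧ ∀ v, P v ↔ ∃ u, u ∈ F v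

section Calculus

variable {n : ℕ} {f g : (Fin n → ZFSet.{0}) → ZFSet.{0}} {P Q : (Fin n → ZFSet.{0}) → Prop}

theorem Rudimentary.upair (hf : Rudimentary f) (hg : Rudimentary g) :
    Rudimentary (fun v => {f v, g v}) := by
  have := Rudimentary.comp (Rudimentary.pair (n := 2) 0 1) (H := ![f, g])
    (by intro i; fin_cases i <;> assumption)
  exact this

theorem Rudimentary.sdiff (hf : Rudimentary f) (hg : Rudimentary g) :
    Rudimentary (fun v => f v \ g v) := by
  have := Rudimentary.comp (Rudimentary.diff (n := 2) 0 1) (H := ![f, g])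
    (by intro i; fin_cases i <;> assumption)
  exact this

/-- The union scheme overwrites the coordinate it ranges over, so `f v` is put in front of an intact
copy of `v`. The bound variable becomes coordinate 0 and the others shift by one: the numerals in
later `.proj` terms are de Bruijn indices. -/
theorem Rudimentary.bUnion {H : ZFSet.{0} → (Fin n → ZFSet.{0}) → ZFSet.{0}}
    (hf : Rudimentary f)
    (hH : Rudimentary (fun w : Fin (n + 1) → ZFSet.{0} => H (w 0) (Fin.tail w))) :
    Rudimentary (fun v => bUnion (f v) (fun y => H y v)) := by
  have := Rudimentary.comp (Rudimentary.union hH)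
    (H := Fin.cons f (fun i v => v i)) (n := n)
    (by
      intro i
      refine Fin.cases ?_ (fun i => ?_) i
      · exact hf
      · exact .proj i)
  convert this using 2 with v
  have key : (fun i => (Fin.cons f (fun i v => v i) : Fin (n + 1) → _) i v) =
      (Fin.cons (f v) v : Fin (n + 1) → ZFSet.{0}) := by
    funext i
    refine Fin.cases rfl (fun i => rfl) i
  rw [key]
  simp only [Fin.update_cons_zero, Fin.cons_zero, Fin.tail_cons]
  rfl

theorem Rudimentary.singleton (hf : Rudimentary f) : Rudimentary (fun v => {f v}) := by
  have := hf.upair hf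
  convert this using 2 with v
  ext; simp

theorem Rudimentary.opair (hf : Rudimentary f) (hg : Rudimentary g) :
    Rudimentary (fun v => ZFSet.pair (f v) (g v)) :=
  hf.singleton.upair (hf.upair hg)

theorem Rudimentary.sUnion (hf : Rudimentary f) : Rudimentary (fun v => (f v).sUnion) := by
  have := hf.bUnion (H := fun y _ => y) (.proj 0)
  convert this using 2 with v
  ext; simp [mem_bUnion]

theorem Rudimentary.sup (hf : Rudimentary f) (hg : Rudimentary g) :
    Rudimentary (fun v => f v ∪ g v) :=
  (hf.upair hg).sUnion

theorem Rudimentary.inf (hf : Rudimentary f) (hg : Rudimentary g) :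
    Rudimentary (fun v => f v ∩ g v) := by
  have := hf.sdiff (hf.sdiff hg)
  convert this using 2 with v
  ext; simp; tauto

theorem Rudimentary.weaken (hf : Rudimentary f) :
    Rudimentary (fun w : Fin (n + 1) → ZFSet.{0} => f (Fin.tail w)) :=
  Rudimentary.comp hf (H := fun i w => Fin.tail w i) (fun i => .proj i.succ)

theorem Rudimentary.guard (hP : RudRel P) (hf : Rudimentary f) :
    Rudimentary (fun v => guard (P v) (f v)) := by
  obtain ⟨F, hF, h⟩ := hP
  -- A union of copies of `f v` indexed by `F v` is `f v` or `∅`, according to whether `F v` is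
  -- inhabited.
  have := hF.bUnion (H := fun _ v => f v) hf.weaken
  convert this using 2 with v
  ext; simp [mem_guard, mem_bUnion, h]; tauto

theorem RudRel.bex {P : ZFSet.{0} → (Fin n → ZFSet.{0}) → Prop} (hf : Rudimentary f)
    (hP : RudRel (fun w : Fin (n + 1) → ZFSet.{0} => P (w 0) (Fin.tail w))) :
    RudRel (fun v => ∃ y ∈ f v, P y v) := by
  obtain ⟨F, hF, h⟩ := hP
  refine ⟨_, hf.bUnion (H := fun y v => F (Fin.cons y v)) ?_, fun v => ?_⟩
  · simpa only [Fin.cons_self_tail] using hF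
  · simp only [mem_bUnion]
    constructor
    · rintro ⟨y, hy, hP⟩
      obtain ⟨u, hu⟩ := (h (Fin.cons y v)).1 (by simpa using hP)
      exact ⟨u, y, hy, hu⟩
    · rintro ⟨u, y, hy, hu⟩
      exact ⟨y, hy, by simpa using (h (Fin.cons y v)).2 ⟨u, hu⟩⟩

theorem RudRel.and (hP : RudRel P) (hQ : RudRel Q) : RudRel (fun v => P v ∧ Q v) := by
  obtain ⟨F, hF, h⟩ := hQ
  exact ⟨_, Rudimentary.guard hP hF, fun v => by simp [mem_guard, h]; tauto⟩

theorem RudRel.or (hP : RudRel P) (hQ : RudRel Q) : RudRel (fun v => P v ∨ Q v) := by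
  obtain ⟨F, hF, h⟩ := hP
  obtain ⟨G, hG, k⟩ := hQ
  exact ⟨_, hF.sup hG, fun v => by simp [k, h, exists_or]⟩

theorem RudRel.not (hP : RudRel P) : RudRel (fun v => ¬ P v) := by
  obtain ⟨F, hF, h⟩ := hP
  -- The subtracted union is `{F v}` when `F v` is inhabited and `∅` otherwise, so the difference is
  -- inhabited exactly when `F v` is empty.
  have h2 := hF.singleton.sdiff (hF.bUnion (H := fun _ v => {F v}) hF.singleton.weaken)
  refine ⟨_, h2, fun v => ?_⟩
  simp [mem_bUnion, h]

theorem RudRel.imp (hP : RudRel P) (hQ : RudRel Q) : RudRel (fun v => P v → Q v) := by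
  simpa only [imp_iff_not_or] using hP.not.or hQ

theorem RudRel.ball {P : ZFSet.{0} → (Fin n → ZFSet.{0}) → Prop} (hf : Rudimentary f)
    (hP : RudRel (fun w : Fin (n + 1) → ZFSet.{0} => P (w 0) (Fin.tail w))) :
    RudRel (fun v => ∀ y ∈ f v, P y v) := by
  simpa using (RudRel.bex (P := fun y v => ¬ P y v) hf hP.not).not

theorem RudRel.nonempty (hf : Rudimentary f) : RudRel (fun v => ∃ u, u ∈ f v) :=
  ⟨f, hf, fun _ => Iff.rfl⟩

theorem RudRel.mem (hf : Rudimentary f) (hg : Rudimentary g) : RudRel (fun v => f v ∈ g v) := by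
  simpa using (RudRel.nonempty (hf.singleton.sdiff hg)).not

theorem RudRel.eq (hf : Rudimentary f) (hg : Rudimentary g) : RudRel (fun v => f v = g v) := by
  simpa using RudRel.mem hf hg.singleton

end Calculus

/-- The union of the sets `H(x, u)` over all ordered pairs `⟨x, u⟩ ∈ r`. -/
noncomputable def pUnion (r : ZFSet.{0}) (H : ZFSet.{0} → ZFSet.{0} → ZFSet.{0}) : ZFSet.{0} :=
  bUnion r fun p => bUnion p.sUnion fun x => bUnion p.sUnion fun u =>
    guard (p = ZFSet.pair x u) (H x u)

/-- Both coordinates of an ordered pair `p` belong to `p.sUnion`, so bounding the unions by it loses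
nothing. -/
theorem mem_pUnion {r t : ZFSet.{0}} {H : ZFSet.{0} → ZFSet.{0} → ZFSet.{0}} :
    t ∈ pUnion r H ↔ ∃ x u, ZFSet.pair x u ∈ r ∧ t ∈ H x u := by
  simp only [pUnion, mem_bUnion, mem_guard]
  constructor
  · rintro ⟨p, hp, x, -, u, -, ht, rfl⟩
    exact ⟨x, u, hp, ht⟩
  · rintro ⟨x, u, h, ht⟩
    exact ⟨_, h, x, by simp [ZFSet.pair], u, by simp [ZFSet.pair], ht, rfl⟩

theorem Rudimentary.pUnion {n : ℕ} {f : (Fin n → ZFSet.{0}) → ZFSet.{0}}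
    {H : ZFSet.{0} → ZFSet.{0} → (Fin n → ZFSet.{0}) → ZFSet.{0}} (hf : Rudimentary f)
    (hH : Rudimentary (fun w : Fin (n + 2) → ZFSet.{0} =>
      H (w 1) (w 0) (Fin.tail (Fin.tail w)))) :
    Rudimentary (fun v => pUnion (f v) (fun x u => H x u v)) := by
  unfold AnalysisJ2.pUnion
  refine hf.bUnion (Rudimentary.bUnion (.sUnion (.proj 0)) (Rudimentary.bUnion
    (.sUnion (.proj 1)) (Rudimentary.guard (.eq (.proj 2) (.opair (.proj 1) (.proj 0))) ?_)))
  -- The reindexing skips coordinate 2, the pair itself, on which `H` does not depend.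
  exact Rudimentary.comp hH (H := fun i w =>
    w (Fin.cases 0 (fun i => Fin.cases 1 (fun i => i.succ.succ.succ) i) i)) (fun i => .proj _)

/-- The domain of a relation. -/
noncomputable def dom (r : ZFSet.{0}) : ZFSet.{0} := pUnion r fun x _ => {x}

theorem mem_dom {r x : ZFSet.{0}} : x ∈ dom r ↔ ∃ u, ZFSet.pair x u ∈ r := by
  simp [dom, mem_pUnion]

theorem Rudimentary.dom {n : ℕ} {f : (Fin n → ZFSet.{0}) → ZFSet.{0}} (hf : Rudimentary f) :
    Rudimentary (fun v => dom (f v)) :=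
  hf.pUnion (H := fun x _ _ => {x}) (.singleton (.proj 1))

/-! ### Operations generating the rudimentary functions -/

/-- Ternary rudimentary functions. -/
def Rud3 (B : ZFSet.{0} → ZFSet.{0} → ZFSet.{0} → ZFSet.{0}) : Prop :=
  Rudimentary (fun v : Fin 3 → ZFSet.{0} => B (v 0) (v 1) (v 2))

theorem Rud3.app {B : ZFSet.{0} → ZFSet.{0} → ZFSet.{0} → ZFSet.{0}} (hB : Rud3 B) {n : ℕ}
    {f g h : (Fin n → ZFSet.{0}) → ZFSet.{0}} (hf : Rudimentary f) (hg : Rudimentary g)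
    (hh : Rudimentary h) : Rudimentary (fun v => B (f v) (g v) (h v)) :=
  Rudimentary.comp hB (H := ![f, g, h]) (by intro i; fin_cases i <;> assumption)

theorem RudClosed.rud3 {J : ZFSet.{0}} (hJ : RudClosed J)
    {B : ZFSet.{0} → ZFSet.{0} → ZFSet.{0} → ZFSet.{0}} (hB : Rud3 B) {x y z : ZFSet.{0}}
    (hx : x ∈ J) (hy : y ∈ J) (hz : z ∈ J) : B x y z ∈ J :=
  hJ hB ![x, y, z] (by intro i; fin_cases i <;> assumption)

/-- The section `{u : ⟨x, u⟩ ∈ r}`. -/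
noncomputable def sect (r x : ZFSet.{0}) : ZFSet.{0} := pUnion r fun x' u => guard (x' = x) {u}

/-- The relation `∋` on `a`. -/
noncomputable def memRel (a : ZFSet.{0}) : ZFSet.{0} :=
  bUnion a fun x => bUnion x fun w => {ZFSet.pair x w}

/-- The first projection on the ordered pairs in `a`. -/
noncomputable def fstRel (a : ZFSet.{0}) : ZFSet.{0} :=
  pUnion a fun u v => {ZFSet.pair (ZFSet.pair u v) u}

/-- The second projection on the ordered pairs in `a`. -/
noncomputable def sndRel (a : ZFSet.{0}) : ZFSet.{0} :=
  pUnion a fun u v => {ZFSet.pair (ZFSet.pair u v) v}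

/-- The composition of relations. -/
noncomputable def compRel (r s : ZFSet.{0}) : ZFSet.{0} :=
  pUnion r fun x u => pUnion s fun u' w => guard (u = u') {ZFSet.pair x w}

/-- The fork of relations: `x` is related to `⟨u, v⟩` if `⟨x, u⟩ ∈ r` and `⟨x, v⟩ ∈ s`. -/
noncomputable def forkRel (r s : ZFSet.{0}) : ZFSet.{0} :=
  pUnion r fun x u => pUnion s fun x' v => guard (x = x') {ZFSet.pair x (ZFSet.pair u v)}

/-- The function on `a` that sends `x` to the section of `r` at `x`. -/
noncomputable def graphRel (r a : ZFSet.{0}) : ZFSet.{0} :=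
  bUnion a fun x => {ZFSet.pair x (sect r x)}

theorem mem_sect {r x u : ZFSet.{0}} : u ∈ sect r x ↔ ZFSet.pair x u ∈ r := by
  simp [sect, mem_pUnion, mem_guard]

theorem mem_memRel {a z : ZFSet.{0}} :
    z ∈ memRel a ↔ ∃ x w, z = ZFSet.pair x w ∧ x ∈ a ∧ w ∈ x := by
  simp only [memRel, mem_bUnion, ZFSet.mem_singleton]; grind

theorem mem_fstRel {a z : ZFSet.{0}} :
    z ∈ fstRel a ↔ ∃ u v, z = ZFSet.pair (ZFSet.pair u v) u ∧ ZFSet.pair u v ∈ a := by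
  simp only [fstRel, mem_pUnion, ZFSet.mem_singleton]; grind

theorem mem_sndRel {a z : ZFSet.{0}} :
    z ∈ sndRel a ↔ ∃ u v, z = ZFSet.pair (ZFSet.pair u v) v ∧ ZFSet.pair u v ∈ a := by
  simp only [sndRel, mem_pUnion, ZFSet.mem_singleton]; grind

theorem mem_compRel {r s z : ZFSet.{0}} : z ∈ compRel r s ↔
    ∃ x u w, z = ZFSet.pair x w ∧ ZFSet.pair x u ∈ r ∧ ZFSet.pair u w ∈ s := by
  simp only [compRel, mem_pUnion, mem_guard, ZFSet.mem_singleton]; grind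

theorem mem_forkRel {r s z : ZFSet.{0}} : z ∈ forkRel r s ↔
    ∃ x u v, z = ZFSet.pair x (ZFSet.pair u v) ∧ ZFSet.pair x u ∈ r ∧ ZFSet.pair x v ∈ s := by
  simp only [forkRel, mem_pUnion, mem_guard, ZFSet.mem_singleton]; grind

theorem mem_graphRel {r a z : ZFSet.{0}} :
    z ∈ graphRel r a ↔ ∃ x, z = ZFSet.pair x (sect r x) ∧ x ∈ a := by
  simp only [graphRel, mem_bUnion, ZFSet.mem_singleton]; grind

/-- The operations other than `A`, as functions of `A`, `x` and `y`. -/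
noncomputable def ops : List (ZFSet.{0} → ZFSet.{0} → ZFSet.{0} → ZFSet.{0}) :=
  [fun _ x y => {x, y}, fun _ x y => x \ y, fun _ x y => sect x y, fun _ x _ => memRel x,
    fun _ x _ => fstRel x, fun _ x _ => sndRel x, fun _ x y => compRel x y,
    fun _ x y => forkRel x y, fun _ x y => graphRel x y]

theorem Rudimentary.sect {n : ℕ} {f g : (Fin n → ZFSet.{0}) → ZFSet.{0}} (hf : Rudimentary f)
    (hg : Rudimentary g) : Rudimentary (fun v => sect (f v) (g v)) :=
  hf.pUnion (H := fun x' u v => AnalysisJ2.guard (x' = g v) {u})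
    (Rudimentary.guard (.eq (.proj 1) hg.weaken.weaken) (.singleton (.proj 0)))

theorem rud3_of_mem_ops {B : ZFSet.{0} → ZFSet.{0} → ZFSet.{0} → ZFSet.{0}} (hB : B ∈ ops) :
    Rud3 B := by
  simp only [ops, List.mem_cons, List.not_mem_nil, or_false] at hB
  rcases hB with rfl | rfl | rfl | rfl | rfl | rfl | rfl | rfl | rfl
  · exact .pair 1 2
  · exact .diff 1 2
  · exact .sect (.proj 1) (.proj 2)
  · exact .bUnion (.proj 1) (.bUnion (.proj 0) (.singleton (.opair (.proj 1) (.proj 0))))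
  · exact .pUnion (.proj 1) (.singleton (.opair (.opair (.proj 1) (.proj 0)) (.proj 1)))
  · exact .pUnion (.proj 1) (.singleton (.opair (.opair (.proj 1) (.proj 0)) (.proj 0)))
  · exact .pUnion (.proj 1) (.pUnion (.proj 4) (.guard (.eq (.proj 2) (.proj 1))
      (.singleton (.opair (.proj 3) (.proj 0)))))
  · exact .pUnion (.proj 1) (.pUnion (.proj 4) (.guard (.eq (.proj 3) (.proj 1))
      (.singleton (.opair (.proj 3) (.opair (.proj 2) (.proj 0))))))
  · exact .bUnion (.proj 2) (.singleton (.opair (.proj 0) (.sect (.proj 2) (.proj 0))))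

/-! ### End extensions of well-orderings -/

/-- `W` is a well-ordering of its domain, which is a nonempty transitive set. -/
structure Good (W : ZFSet.{0}) : Prop where
  pairs : ∀ z ∈ W, ∃ a ∈ dom W, ∃ b ∈ dom W, z = ZFSet.pair a b
  wo : WellOrders (W : Set ZFSet.{0}) (dom W : Set ZFSet.{0})
  trans : (dom W).IsTransitive
  nonempty : ∃ a, a ∈ dom W

/-- `V` end-extends `W`. -/
structure EndExtends (V W : ZFSet.{0}) : Prop where
  subset : W ⊆ V
  mem : ∀ a b, b ∈ dom W → ZFSet.pair a b ∈ V → ZFSet.pair a b ∈ W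

theorem Good.left_mem {W a b : ZFSet.{0}} (hW : Good W) (h : ZFSet.pair a b ∈ W) : a ∈ dom W := by
  obtain ⟨a', ha, b', hb, h⟩ := hW.pairs _ h
  obtain ⟨rfl, rfl⟩ := ZFSet.pair_injective h
  exact ha

theorem EndExtends.dom_subset {V W : ZFSet.{0}} (h : EndExtends V W) : dom W ⊆ dom V := by
  intro a ha
  obtain ⟨u, hu⟩ := mem_dom.1 ha
  exact mem_dom.2 ⟨u, h.subset hu⟩

theorem EndExtends.refl (W : ZFSet.{0}) : EndExtends W W := ⟨fun _ h => h, fun _ _ _ h => h⟩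

theorem EndExtends.trans {U V W : ZFSet.{0}} (h : EndExtends U V) (k : EndExtends V W) :
    EndExtends U W :=
  ⟨fun _ hz => h.subset (k.subset hz),
    fun a b hb hab => k.mem a b hb (h.mem a b (k.dom_subset hb) hab)⟩

theorem WellOrders.exists_linearOrder {W X : Set ZFSet.{0}} (h : WellOrders W X) :
    ∃ (ι : Type 1) (_ : LinearOrder ι) (_ : WellFoundedLT ι) (e : X ≃ ι),
      ∀ a b : X, ZFSet.pair (a : ZFSet.{0}) b ∈ W ↔ e a ≤ e b := by
  let o : LinearOrder X :=
    { le := fun a b => ZFSet.pair a b ∈ W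
      lt := fun a b => ZFSet.pair a b ∈ W ∧ ZFSet.pair b a ∉ W
      le_refl := fun a => h.refl a a.2
      le_trans := fun a b c => h.trans a a.2 b b.2 c c.2
      le_antisymm := fun a b hab hba => Subtype.ext (h.antisymm a a.2 b b.2 hab hba)
      le_total := fun a b => h.total a a.2 b b.2
      toDecidableLE := Classical.decRel _ }
  refine ⟨X, o, ⟨WellFounded.wellFounded_iff_has_min.2 fun s hs => ?_⟩, Equiv.refl X,
    fun a b => Iff.rfl⟩
  obtain ⟨a, ha, hmin⟩ := h.exists_least (Subtype.val '' s) (by simp) (hs.image _)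
  obtain ⟨a, has, rfl⟩ := ha
  exact ⟨a, has, fun b hb hlt => hlt.2 (hmin b ⟨b, hb, rfl⟩)⟩

theorem WellOrders.of_injective {W X : Set ZFSet.{0}} {ι : Type*} [LinearOrder ι] [WellFoundedLT ι]
    (f : X → ι) (hf : Function.Injective f)
    (hW : ∀ a b : X, ZFSet.pair a b ∈ W ↔ f a ≤ f b) : WellOrders W X where
  refl a ha := (hW ⟨a, ha⟩ ⟨a, ha⟩).2 le_rfl
  antisymm a ha b hb h k := congrArg Subtype.val <| hf <|
    le_antisymm ((hW ⟨a, ha⟩ ⟨b, hb⟩).1 h) ((hW ⟨b, hb⟩ ⟨a, ha⟩).1 k)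
  trans a ha b hb c hc h k := (hW ⟨a, ha⟩ ⟨c, hc⟩).2 <|
    le_trans ((hW ⟨a, ha⟩ ⟨b, hb⟩).1 h) ((hW ⟨b, hb⟩ ⟨c, hc⟩).1 k)
  total a ha b hb := by
    rw [hW ⟨a, ha⟩ ⟨b, hb⟩, hW ⟨b, hb⟩ ⟨a, ha⟩]
    exact le_total _ _
  exists_least S hS hne := by
    obtain ⟨a, ha, hmin⟩ := WellFounded.has_min (InvImage.wf f wellFounded_lt)
      {x : X | (x : ZFSet.{0}) ∈ S} (by obtain ⟨a, ha⟩ := hne; exact ⟨⟨a, hS ha⟩, ha⟩)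
    exact ⟨a, ha, fun b hb => (hW a ⟨b, hS hb⟩).2 (not_lt.1 (hmin ⟨b, hS hb⟩ hb))⟩

section Extension

variable (B : ZFSet.{0} → ZFSet.{0} → ZFSet.{0} → ZFSet.{0})

/-- The sets `B(A, x, y) ∩ A` for `x, y ∈ A`. -/
noncomputable def img (A : ZFSet.{0}) : ZFSet.{0} :=
  bUnion A fun x => bUnion A fun y => {B A x y ∩ A}

/-- The order on the end extension of `W`: the elements of `A` come first and the other ones are
compared by their lexicographically least codes `(x, y)`. -/
def ExtLE (W A z z' : ZFSet.{0}) : Prop :=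
  (z ∈ A ∧ (z' ∈ A → ZFSet.pair z z' ∈ W)) ∨ (z ∉ A ∧ z' ∉ A ∧
    ∃ x ∈ A, ∃ y ∈ A, B A x y ∩ A = z ∧ ∀ x' ∈ A, ∀ y' ∈ A, B A x' y' ∩ A = z' →
      ZFSet.pair x x' ∈ W ∧ (ZFSet.pair x' x ∈ W → ZFSet.pair y y' ∈ W))

/-- The end extension of the well-ordering `W` by the sets `B(A, x, y) ∩ A`, with `A = dom W`. -/
noncomputable def ext (W : ZFSet.{0}) : ZFSet.{0} :=
  bUnion (dom W ∪ img B (dom W)) fun z => bUnion (dom W ∪ img B (dom W)) fun z' =>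
    guard (ExtLE B W (dom W) z z') {ZFSet.pair z z'}

variable {B}

theorem mem_img {A z : ZFSet.{0}} : z ∈ img B A ↔ ∃ x ∈ A, ∃ y ∈ A, B A x y ∩ A = z := by
  simp [img, mem_bUnion, eq_comm]

theorem mem_ext {W t : ZFSet.{0}} : t ∈ ext B W ↔ ∃ z z', t = ZFSet.pair z z' ∧
    z ∈ dom W ∪ img B (dom W) ∧ z' ∈ dom W ∪ img B (dom W) ∧ ExtLE B W (dom W) z z' := by
  simp only [ext, mem_bUnion, mem_guard, ZFSet.mem_singleton]; grind

theorem pair_mem_ext {W z z' : ZFSet.{0}} : ZFSet.pair z z' ∈ ext B W ↔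
    z ∈ dom W ∪ img B (dom W) ∧ z' ∈ dom W ∪ img B (dom W) ∧ ExtLE B W (dom W) z z' := by
  rw [mem_ext]
  constructor
  · rintro ⟨a, b, h, k⟩
    obtain ⟨rfl, rfl⟩ := ZFSet.pair_injective h
    exact k
  · exact fun h => ⟨z, z', rfl, h⟩

/-- With `ι` the order type of `W`, old elements embed in the left summand of `ι ⊕ₗ (ι ×ₗ ι)` and
each new one goes to its least code in the right summand. The order is pulled back along this
injection. -/
theorem Good.wellOrders_ext {W : ZFSet.{0}} (hW : Good W) :
    WellOrders (ext B W : Set ZFSet.{0}) (dom W ∪ img B (dom W) : ZFSet.{0}) := by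
  classical
  set A := dom W with hA
  obtain ⟨ι, _, _, e, he⟩ := hW.wo.exists_linearOrder
  let d : ι → ZFSet.{0} := fun i => (e.symm i : ZFSet.{0})
  have hd : ∀ i, d i ∈ A := fun i => (e.symm i).2
  have le_def : ∀ i j : ι, i ≤ j ↔ ZFSet.pair (d i) (d j) ∈ W := fun i j => by
    simpa using (he (e.symm i) (e.symm j)).symm
  have d_e : ∀ (z : ZFSet.{0}) (hz : z ∈ A), d (e ⟨z, hz⟩) = z := fun z hz => by simp [d]
  let val : ι ×ₗ ι → ZFSet.{0} := fun c => B A (d (ofLex c).1) (d (ofLex c).2) ∩ A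
  -- A default code, needed by `choose!` to make the least-code function total.
  have : Nonempty (ι ×ₗ ι) := by
    obtain ⟨a, ha⟩ := hW.nonempty
    exact ⟨toLex (e ⟨a, ha⟩, e ⟨a, ha⟩)⟩
  have : WellFoundedLT (ι ⊕ₗ (ι ×ₗ ι)) :=
    ⟨Sum.lex_wf wellFounded_lt wellFounded_lt⟩
  have hcode : ∀ z : (A ∪ img B A : ZFSet.{0}), (z : ZFSet.{0}) ∉ A →
      ∃ c : ι ×ₗ ι, val c = z ∧ ∀ c', val c' = z → c ≤ c' := by
    intro z hz
    obtain ⟨x, hx, y, hy, h⟩ := mem_img.1 ((ZFSet.mem_union.1 z.2).resolve_left hz)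
    obtain ⟨c, hc, hmin⟩ := WellFounded.has_min (wellFounded_lt (α := ι ×ₗ ι))
      {c | val c = z} ⟨toLex (e ⟨x, hx⟩, e ⟨y, hy⟩),
        by simpa only [val, d_e, ofLex_toLex, Set.mem_ofPred_eq] using h⟩
    exact ⟨c, hc, fun c' hc' => not_lt.1 (hmin c' hc')⟩
  choose! m hm hmin using hcode
  let f : (A ∪ img B A : ZFSet.{0}) → ι ⊕ₗ (ι ×ₗ ι) := fun z =>
    if h : (z : ZFSet.{0}) ∈ A then Sum.inlₗ (e ⟨z, h⟩) else Sum.inrₗ (m z)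
  refine WellOrders.of_injective f ?_ ?_
  · intro z z' h
    by_cases hz : (z : ZFSet.{0}) ∈ A <;> by_cases hz' : (z' : ZFSet.{0}) ∈ A
    · simp only [f, hz, hz', dif_pos] at h
      have h := e.injective (Sum.inl_injective (toLex.injective h))
      exact Subtype.ext (Subtype.mk.inj h)
    · simp only [f, hz, hz', dif_pos] at h
      exact absurd (toLex.injective h) (by simp)
    · simp only [f, hz, hz', dif_pos] at h
      exact absurd (toLex.injective h) (by simp)
    · simp only [f, hz, hz'] at h
      have h := Sum.inr_injective (toLex.injective h)
      exact Subtype.ext (by rw [← hm z hz, ← hm z' hz', h])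
  · intro z z'
    have hz₀ : (z : ZFSet.{0}) ∈ A ∪ img B A := z.2
    have hz₁ : (z' : ZFSet.{0}) ∈ A ∪ img B A := z'.2
    rw [SetLike.mem_coe, pair_mem_ext, ← hA, and_iff_right hz₀, and_iff_right hz₁, ExtLE]
    by_cases hz : (z : ZFSet.{0}) ∈ A <;> by_cases hz' : (z' : ZFSet.{0}) ∈ A
    · simp only [f, hz, hz', dif_pos, Sum.Lex.inl_le_inl_iff]
      simp [le_def, d_e]
    · simp only [f, hz, hz', dif_pos]
      simp
    · simp only [f, hz, hz', dif_pos]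
      simp
    · simp only [f, hz, hz', Sum.Lex.inr_le_inr_iff, dif_neg, not_false_eq_true, true_and,
        false_and, false_or]
      have lex : ∀ c c' : ι ×ₗ ι, c ≤ c' ↔
          ZFSet.pair (d (ofLex c).1) (d (ofLex c').1) ∈ W ∧
          (ZFSet.pair (d (ofLex c').1) (d (ofLex c).1) ∈ W →
            ZFSet.pair (d (ofLex c).2) (d (ofLex c').2) ∈ W) := by
        intro c c'
        rw [Prod.Lex.le_iff, ← le_def, ← le_def, ← le_def]
        constructor
        · rintro (h | ⟨h, k⟩)
          · exact ⟨h.le, fun k => absurd k (not_le.2 h)⟩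
          · exact ⟨h.le, fun _ => k⟩
        · rintro ⟨h, k⟩
          rcases h.lt_or_eq with h | h
          · exact .inl h
          · exact .inr ⟨h, k h.ge⟩
      constructor
      · rintro ⟨x, hx, y, hy, h, k⟩
        refine (hmin z hz (toLex (e ⟨x, hx⟩, e ⟨y, hy⟩)) ?_).trans ((lex _ _).2 ?_)
        · simpa only [val, d_e, ofLex_toLex] using h
        · simpa only [d_e, ofLex_toLex] using k _ (hd _) _ (hd _) (hm z' hz')
      · intro h
        refine ⟨_, hd _, _, hd _, hm z hz, fun x' hx' y' hy' k => ?_⟩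
        have := (lex _ (toLex (e ⟨x', hx'⟩, e ⟨y', hy'⟩))).1 (h.trans (hmin z' hz' _ (by
          simpa only [val, d_e, ofLex_toLex] using k)))
        simpa only [d_e, ofLex_toLex] using this

theorem Good.dom_ext {W : ZFSet.{0}} (hW : Good W) :
    dom (ext B W) = dom W ∪ img B (dom W) := by
  ext a
  rw [mem_dom]
  constructor
  · rintro ⟨u, hu⟩
    exact (pair_mem_ext.1 hu).1
  · exact fun h => ⟨a, hW.wellOrders_ext.refl a h⟩

theorem Good.endExtends_ext {W : ZFSet.{0}} (hW : Good W) : EndExtends (ext B W) W where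
  subset z hz := by
    obtain ⟨a, ha, b, hb, rfl⟩ := hW.pairs z hz
    exact pair_mem_ext.2 ⟨ZFSet.mem_union.2 (.inl ha), ZFSet.mem_union.2 (.inl hb),
      .inl ⟨ha, fun _ => hz⟩⟩
  mem a b hb h := by
    rcases (pair_mem_ext.1 h).2.2 with ⟨-, h⟩ | ⟨-, h, -⟩
    · exact h hb
    · exact absurd hb h

theorem Good.ext {W : ZFSet.{0}} (hW : Good W) : Good (ext B W) where
  pairs z hz := by
    rw [hW.dom_ext]
    obtain ⟨a, b, rfl, ha, hb, -⟩ := mem_ext.1 hz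
    exact ⟨a, ha, b, hb, rfl⟩
  wo := by rw [hW.dom_ext]; exact hW.wellOrders_ext
  trans := by
    rw [hW.dom_ext]
    intro y hy t ht
    refine ZFSet.mem_union.2 (.inl ?_)
    rcases ZFSet.mem_union.1 hy with hy | hy
    · exact hW.trans y hy ht
    · obtain ⟨a, -, b, -, rfl⟩ := mem_img.1 hy
      exact (ZFSet.mem_inter.1 ht).2
  nonempty := by
    obtain ⟨a, ha⟩ := hW.nonempty
    exact ⟨a, hW.endExtends_ext.dom_subset ha⟩

theorem Rudimentary.ext {n : ℕ} {f : (Fin n → ZFSet.{0}) → ZFSet.{0}} (hB : Rud3 B)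
    (hf : Rudimentary f) : Rudimentary (fun v => ext B (f v)) := by
  have h1 : Rudimentary (fun v : Fin 1 → ZFSet.{0} => v 0) := .proj 0
  have hd := h1.dom
  have img : Rudimentary (fun v : Fin 1 → ZFSet.{0} =>
      AnalysisJ2.dom (v 0) ∪ img B (AnalysisJ2.dom (v 0))) :=
    hd.sup (.bUnion hd (.bUnion hd.weaken (.singleton
      (.inf (hB.app hd.weaken.weaken (.proj 1) (.proj 0)) hd.weaken.weaken))))
  have key : Rudimentary (fun v : Fin 1 → ZFSet.{0} => AnalysisJ2.ext B (v 0)) := by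
    refine .bUnion img (.bUnion img.weaken (.guard ?_ (.singleton (.opair (.proj 1) (.proj 0)))))
    -- Coordinates from 0 upwards are `z', z, W` at `d3`; then `y, x` and finally `y', x'` are put
    -- in front at `d5` and `d7`.
    have d3 := hd.weaken.weaken
    have d5 := d3.weaken.weaken
    have d7 := d5.weaken.weaken
    refine .or (.and (.mem (.proj 1) d3) (.imp (.mem (.proj 0) d3)
      (.mem (.opair (.proj 1) (.proj 0)) (.proj 2)))) (.and (.not (.mem (.proj 1) d3))
      (.and (.not (.mem (.proj 0) d3)) (.bex d3 (.bex d3.weaken (.and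
        (.eq (.inf (hB.app d5 (.proj 1) (.proj 0)) d5) (.proj 3)) (.ball d5 (.ball d5.weaken
        (.imp (.eq (.inf (hB.app d7 (.proj 1) (.proj 0)) d7) (.proj 4)) (.and
          (.mem (.opair (.proj 3) (.proj 1)) (.proj 6)) (.imp
            (.mem (.opair (.proj 1) (.proj 3)) (.proj 6))
            (.mem (.opair (.proj 2) (.proj 0)) (.proj 6))))))))))))
  exact Rudimentary.comp key (H := fun _ => f) (fun _ => hf)

/-- The end extension of `W` by all the operations. -/
noncomputable def step (W : ZFSet.{0}) : ZFSet.{0} :=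
  ops.foldl (fun V B => ext B V) (ext (fun A _ _ => A) W)

theorem Rudimentary.step {n : ℕ} {f : (Fin n → ZFSet.{0}) → ZFSet.{0}} (hf : Rudimentary f) :
    Rudimentary (fun v => step (f v)) := by
  have key : ∀ (l : List (ZFSet.{0} → ZFSet.{0} → ZFSet.{0} → ZFSet.{0})), (∀ B ∈ l, Rud3 B) →
      ∀ g : (Fin n → ZFSet.{0}) → ZFSet.{0}, Rudimentary g →
      Rudimentary (fun v => l.foldl (fun V B => AnalysisJ2.ext B V) (g v)) := by
    intro l
    induction l with
    | nil => exact fun _ g hg => hg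
    | cons B l ih =>
      intro hl g hg
      exact ih (fun C hC => hl C (List.mem_cons_of_mem _ hC)) _
        (.ext (hl B List.mem_cons_self) hg)
  exact key ops (fun B hB => rud3_of_mem_ops hB) _ (.ext (.proj 0) hf)

theorem Good.foldl_ext (l : List (ZFSet.{0} → ZFSet.{0} → ZFSet.{0} → ZFSet.{0})) {W : ZFSet.{0}}
    (hW : Good W) : Good (l.foldl (fun V B => AnalysisJ2.ext B V) W) ∧
      EndExtends (l.foldl (fun V B => AnalysisJ2.ext B V) W) W := by
  induction l generalizing W with
  | nil => exact ⟨hW, .refl W⟩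
  | cons B l ih =>
    obtain ⟨h, k⟩ := ih (hW.ext (B := B))
    exact ⟨h, k.trans hW.endExtends_ext⟩

theorem Good.step {W : ZFSet.{0}} (hW : Good W) : Good (step W) :=
  (Good.foldl_ext ops hW.ext).1

theorem Good.endExtends_step {W : ZFSet.{0}} (hW : Good W) : EndExtends (AnalysisJ2.step W) W :=
  (Good.foldl_ext ops hW.ext).2.trans hW.endExtends_ext

theorem Good.dom_mem_dom_step {W : ZFSet.{0}} (hW : Good W) : dom W ∈ dom (AnalysisJ2.step W) := by
  refine (Good.foldl_ext ops hW.ext).2.dom_subset ?_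
  obtain ⟨a, ha⟩ := hW.nonempty
  rw [hW.dom_ext, ZFSet.mem_union, mem_img]
  -- The constant operation yields `A ∩ A = A`; the arguments are irrelevant but must exist, hence
  -- nonemptiness in `Good`.
  exact .inr ⟨a, ha, a, ha, by ext; simp⟩

/-- New sets are cut down to the current domain, which keeps it transitive; a value already
contained in `dom W` survives uncut. The first argument is existential because it is the domain at
the stage where `B` has its turn; the operations in `ops` ignore it. -/
theorem Good.op_mem_dom_step {W x y : ZFSet.{0}} (hW : Good W)
    {B : ZFSet.{0} → ZFSet.{0} → ZFSet.{0} → ZFSet.{0}} (hB : B ∈ ops)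
    (hx : x ∈ dom W) (hy : y ∈ dom W) (h : ∀ A, B A x y ⊆ dom W) :
    ∃ A, B A x y ∈ dom (AnalysisJ2.step W) := by
  have key : ∀ (l : List (ZFSet.{0} → ZFSet.{0} → ZFSet.{0} → ZFSet.{0})) (V : ZFSet.{0}),
      Good V → EndExtends V W → B ∈ l →
      ∃ A, B A x y ∈ dom (l.foldl (fun V B => AnalysisJ2.ext B V) V) := by
    intro l
    induction l with
    | nil => simp
    | cons C l ih =>
      intro V hV hVW hl
      rcases List.mem_cons.1 hl with rfl | hl
      · refine ⟨dom V, (Good.foldl_ext l (hV.ext (B := B))).2.dom_subset ?_⟩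
        rw [hV.dom_ext, ZFSet.mem_union, mem_img]
        refine .inr ⟨x, hVW.dom_subset hx, y, hVW.dom_subset hy, ?_⟩
        ext t
        rw [ZFSet.mem_inter]
        exact ⟨fun ht => ht.1, fun ht => ⟨ht, hVW.dom_subset (h _ ht)⟩⟩
      · exact ih _ hV.ext (hV.endExtends_ext.trans hVW) hl
  exact key ops _ hW.ext hW.endExtends_ext hB

theorem RudClosed.rud1 {J : ZFSet.{0}} (hJ : RudClosed J) {F : ZFSet.{0} → ZFSet.{0}}
    (hF : Rudimentary (fun v : Fin 1 → ZFSet.{0} => F (v 0))) {x : ZFSet.{0}}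
    (hx : x ∈ J) : F x ∈ J :=
  hJ hF ![x] (by intro i; fin_cases i; assumption)

theorem RudClosed.dom_ext_subset {J W : ZFSet.{0}} (hJ : RudClosed J) (hB : Rud3 B)
    (hG : Good W) (hW : W ∈ J) (h : dom W ⊆ J) : dom (ext B W) ⊆ J := by
  have hd : dom W ∈ J := hJ.rud1 (.dom (.proj 0)) hW
  rw [hG.dom_ext]
  intro z hz
  rcases ZFSet.mem_union.1 hz with hz | hz
  · exact h hz
  · obtain ⟨x, hx, y, hy, rfl⟩ := mem_img.1 hz
    exact hJ.rud3 (B := fun A x y => B A x y ∩ A) (.inf hB (.proj 0)) hd (h hx) (h hy)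

theorem RudClosed.dom_step_subset {J W : ZFSet.{0}} (hJ : RudClosed J)
    (hG : Good W) (hW : W ∈ J) (h : dom W ⊆ J) : dom (step W) ⊆ J := by
  have key : ∀ (l : List (ZFSet.{0} → ZFSet.{0} → ZFSet.{0} → ZFSet.{0})), (∀ B ∈ l, Rud3 B) →
      ∀ V : ZFSet.{0}, Good V → V ∈ J → dom V ⊆ J →
        dom (l.foldl (fun V B => ext B V) V) ⊆ J := by
    intro l
    induction l with
    | nil => exact fun _ V _ _ h => h
    | cons B l ih =>
      intro hl V hV hVJ hd
      have hB := hl B List.mem_cons_self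
      exact ih (fun C hC => hl C (List.mem_cons_of_mem _ hC)) _ hV.ext
        (hJ.rud1 (.ext hB (.proj 0)) hVJ) (hJ.dom_ext_subset hB hV hVJ hd)
  exact key ops (fun B hB => rud3_of_mem_ops hB) _ hG.ext
    (hJ.rud1 (.ext (B := fun A _ _ => A) (.proj 0) (.proj 0)) hW)
    (hJ.dom_ext_subset (B := fun A _ _ => A) (.proj 0) hG hW h)

end Extension

/-! ### The tower of well-orderings and its closure under rudimentary functions -/

/-- The iterated end extensions of `p`. -/
noncomputable def tower (p : ZFSet.{0}) (n : ℕ) : ZFSet.{0} := step^[n] p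

/-- The domains of the iterated end extensions of `p`. -/
noncomputable def level (p : ZFSet.{0}) (n : ℕ) : ZFSet.{0} := dom (tower p n)

theorem tower_succ (p : ZFSet.{0}) (n : ℕ) : tower p (n + 1) = step (tower p n) :=
  Function.iterate_succ_apply' step n p

theorem Good.tower {p : ZFSet.{0}} (hp : Good p) (n : ℕ) : Good (tower p n) := by
  induction n with
  | zero => exact hp
  | succ n ih => rw [tower_succ]; exact ih.step

theorem Good.endExtends_tower {p : ZFSet.{0}} (hp : Good p) {m n : ℕ} (h : m ≤ n) :
    EndExtends (AnalysisJ2.tower p n) (AnalysisJ2.tower p m) := by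
  induction n, h using Nat.le_induction with
  | base => exact .refl _
  | succ n _ ih => rw [tower_succ]; exact (hp.tower n).endExtends_step.trans ih

theorem Good.level_mono {p : ZFSet.{0}} (hp : Good p)
    {m n : ℕ} (h : m ≤ n) : level p m ⊆ level p n :=
  (hp.endExtends_tower h).dom_subset

theorem Good.level_mem_level {p : ZFSet.{0}} (hp : Good p)
    (n : ℕ) : level p n ∈ level p (n + 1) := by
  rw [level, level, tower_succ]
  exact (hp.tower n).dom_mem_dom_step

theorem Good.subset_level {p : ZFSet.{0}} (hp : Good p)
    {n : ℕ} {z : ZFSet.{0}} (h : z ∈ level p n) : z ⊆ level p n :=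
  (hp.tower n).trans z h

theorem Good.op_mem_level {p : ZFSet.{0}} (hp : Good p) {n : ℕ} {x y : ZFSet.{0}}
    {B : ZFSet.{0} → ZFSet.{0} → ZFSet.{0} → ZFSet.{0}} (hB : B ∈ ops)
    (hx : x ∈ level p n) (hy : y ∈ level p n) (h : ∀ A, B A x y ⊆ level p n) :
    ∃ A, B A x y ∈ level p (n + 1) := by
  rw [level, tower_succ]
  exact (hp.tower n).op_mem_dom_step hB hx hy h

theorem Good.upair_mem_level {p : ZFSet.{0}} (hp : Good p)
    {n : ℕ} {x y : ZFSet.{0}} (hx : x ∈ level p n)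
    (hy : y ∈ level p n) : {x, y} ∈ level p (n + 1) := by
  refine (hp.op_mem_level (B := fun _ x y => {x, y}) (by simp [ops]) hx hy fun _ t ht => ?_).elim
    fun _ h => h
  rcases ZFSet.mem_pair.1 ht with rfl | rfl <;> assumption

theorem Good.pair_mem_level {p : ZFSet.{0}} (hp : Good p)
    {n : ℕ} {x y : ZFSet.{0}} (hx : x ∈ level p n)
    (hy : y ∈ level p n) : ZFSet.pair x y ∈ level p (n + 2) := by
  have h := hp.upair_mem_level hx hx
  have e : ({x, x} : ZFSet.{0}) = {x} := by ext; simp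
  rw [e] at h
  exact hp.upair_mem_level h (hp.upair_mem_level hx hy)

theorem Good.left_mem_level {p : ZFSet.{0}} (hp : Good p)
    {n : ℕ} {x y : ZFSet.{0}} (h : ZFSet.pair x y ∈ level p n) :
    x ∈ level p n :=
  hp.subset_level (hp.subset_level h (show {x} ∈ ZFSet.pair x y by simp [ZFSet.pair])) (by simp)

theorem Good.right_mem_level {p : ZFSet.{0}} (hp : Good p)
    {n : ℕ} {x y : ZFSet.{0}} (h : ZFSet.pair x y ∈ level p n) :
    y ∈ level p n :=
  hp.subset_level (hp.subset_level h (show {x, y} ∈ ZFSet.pair x y by simp [ZFSet.pair])) (by simp)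

theorem Good.diff_mem_level {p : ZFSet.{0}} (hp : Good p)
    {n : ℕ} {x y : ZFSet.{0}} (hx : x ∈ level p n)
    (hy : y ∈ level p n) : x \ y ∈ level p (n + 1) :=
  (hp.op_mem_level (B := fun _ x y => x \ y) (by simp [ops]) hx hy fun _ _ ht =>
    hp.subset_level hx (ZFSet.mem_sdiff.1 ht).1).elim fun _ h => h

theorem Good.sect_mem_level {p : ZFSet.{0}} (hp : Good p)
    {n : ℕ} {x y : ZFSet.{0}} (hx : x ∈ level p n)
    (hy : y ∈ level p n) : sect x y ∈ level p (n + 1) :=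
  (hp.op_mem_level (B := fun _ x y => sect x y) (by simp [ops]) hx hy fun _ _ ht =>
    hp.right_mem_level (hp.subset_level hx (mem_sect.1 ht))).elim fun _ h => h

/-- A relation is local if its restriction to each level is a set in some level. -/
def IsLocal (p : ZFSet.{0}) (ρ : ZFSet.{0} → ZFSet.{0} → Prop) : Prop :=
  ∀ n, ∃ m, ∃ r ∈ level p m, ∀ z, z ∈ r ↔ ∃ x w, z = ZFSet.pair x w ∧ x ∈ level p n ∧ ρ x w

/-- Level `n` is itself an element of later levels, so `memRel` can be applied to it. The resulting
pairs lie in level `n + 2`, where nothing is cut off. The projections are treated alike. -/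
theorem Good.isLocal_mem {p : ZFSet.{0}} (hp : Good p) : IsLocal p fun x w => w ∈ x := by
  intro n
  obtain ⟨-, h⟩ := hp.op_mem_level (n := n + 2) (B := fun _ x _ => memRel x) (by simp [ops])
    (hp.level_mono (by omega) (hp.level_mem_level n))
    (hp.level_mono (by omega) (hp.level_mem_level n)) fun _ z hz => by
      obtain ⟨x, w, rfl, hx, hw⟩ := mem_memRel.1 hz
      exact hp.pair_mem_level hx (hp.subset_level hx hw)
  exact ⟨_, _, h, fun z => mem_memRel⟩

theorem Good.isLocal_fst {p : ZFSet.{0}} (hp : Good p)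
    :
    IsLocal p fun x w => ∃ v, x = ZFSet.pair w v := by
  intro n
  obtain ⟨-, h⟩ := hp.op_mem_level (n := n + 2) (B := fun _ x _ => fstRel x) (by simp [ops])
    (hp.level_mono (by omega) (hp.level_mem_level n))
    (hp.level_mono (by omega) (hp.level_mem_level n)) fun _ z hz => by
      obtain ⟨u, v, rfl, hx⟩ := mem_fstRel.1 hz
      exact hp.pair_mem_level hx (hp.left_mem_level hx)
  refine ⟨_, _, h, fun z => ?_⟩
  rw [mem_fstRel]
  constructor
  · rintro ⟨u, v, rfl, h⟩
    exact ⟨_, _, rfl, h, v, rfl⟩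
  · rintro ⟨_, u, rfl, h, v, rfl⟩
    exact ⟨u, v, rfl, h⟩

theorem Good.isLocal_snd {p : ZFSet.{0}} (hp : Good p)
    : IsLocal p fun x w => ∃ u, x = ZFSet.pair u w := by
  intro n
  obtain ⟨-, h⟩ := hp.op_mem_level (n := n + 2) (B := fun _ x _ => sndRel x) (by simp [ops])
    (hp.level_mono (by omega) (hp.level_mem_level n))
    (hp.level_mono (by omega) (hp.level_mem_level n)) fun _ z hz => by
      obtain ⟨u, v, rfl, hx⟩ := mem_sndRel.1 hz
      exact hp.pair_mem_level hx (hp.right_mem_level hx)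
  refine ⟨_, _, h, fun z => ?_⟩
  rw [mem_sndRel]
  constructor
  · rintro ⟨u, v, rfl, h⟩
    exact ⟨_, _, rfl, h, u, rfl⟩
  · rintro ⟨_, v, rfl, h, u, rfl⟩
    exact ⟨u, v, rfl, h⟩

/-! ### Closure properties of local relations -/

section Local

variable {ρ σ : ZFSet.{0} → ZFSet.{0} → Prop}

theorem Good.isLocal_comp {p : ZFSet.{0}} (hp : Good p) (hρ : IsLocal p ρ) (hσ : IsLocal p σ) :
    IsLocal p fun x w => ∃ u, ρ x u ∧ σ u w := by
  intro n
  obtain ⟨m, r, hr, hr'⟩ := hρ n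
  -- Intermediate values need not lie in level `n`, but they do lie in level `m`, which contains
  -- `r`; so `σ` is restricted to level `m`.
  obtain ⟨k, s, hs, hs'⟩ := hσ m
  obtain ⟨-, h⟩ := hp.op_mem_level (n := m + k + 2) (B := fun _ x y => compRel x y)
    (by simp [ops]) (hp.level_mono (by omega) hr) (hp.level_mono (by omega) hs) fun _ z hz => by
      obtain ⟨x, u, w, rfl, hx, hu⟩ := mem_compRel.1 hz
      exact hp.pair_mem_level
        (hp.level_mono (by omega) (hp.left_mem_level (hp.subset_level hr hx)))
        (hp.level_mono (by omega) (hp.right_mem_level (hp.subset_level hs hu)))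
  refine ⟨_, _, h, fun z => ?_⟩
  rw [mem_compRel]
  constructor
  · rintro ⟨x, u, w, rfl, hx, hu⟩
    obtain ⟨x', u', e, hxn, hxu⟩ := (hr' _).1 hx
    obtain ⟨rfl, rfl⟩ := ZFSet.pair_injective e
    obtain ⟨u', w', e, -, huw⟩ := (hs' _).1 hu
    obtain ⟨rfl, rfl⟩ := ZFSet.pair_injective e
    exact ⟨_, _, rfl, hxn, _, hxu, huw⟩
  · rintro ⟨x, w, rfl, hx, u, hxu, huw⟩
    have hu := (hr' _).2 ⟨x, u, rfl, hx, hxu⟩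
    exact ⟨x, u, w, rfl, hu, (hs' _).2
      ⟨u, w, rfl, hp.right_mem_level (hp.subset_level hr hu), huw⟩⟩

theorem Good.isLocal_fork {p : ZFSet.{0}} (hp : Good p) (hρ : IsLocal p ρ) (hσ : IsLocal p σ) :
    IsLocal p fun x w => ∃ u v, w = ZFSet.pair u v ∧ ρ x u ∧ σ x v := by
  intro n
  obtain ⟨m, r, hr, hr'⟩ := hρ n
  obtain ⟨k, s, hs, hs'⟩ := hσ n
  obtain ⟨-, h⟩ := hp.op_mem_level (n := m + k + 4) (B := fun _ x y => forkRel x y)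
    (by simp [ops]) (hp.level_mono (by omega) hr) (hp.level_mono (by omega) hs) fun _ z hz => by
      obtain ⟨x, u, v, rfl, hx, hu⟩ := mem_forkRel.1 hz
      exact hp.pair_mem_level
        (hp.level_mono (by omega) (hp.left_mem_level (hp.subset_level hr hx)))
        (hp.pair_mem_level
        (hp.level_mono (by omega) (hp.right_mem_level (hp.subset_level hr hx)))
        (hp.level_mono (by omega) (hp.right_mem_level (hp.subset_level hs hu))))
  refine ⟨_, _, h, fun z => ?_⟩
  rw [mem_forkRel]
  constructor
  · rintro ⟨x, u, v, rfl, hx, hu⟩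
    obtain ⟨x', u', e, hxn, hxu⟩ := (hr' _).1 hx
    obtain ⟨rfl, rfl⟩ := ZFSet.pair_injective e
    obtain ⟨u', w', e, -, huw⟩ := (hs' _).1 hu
    obtain ⟨rfl, rfl⟩ := ZFSet.pair_injective e
    exact ⟨_, _, rfl, hxn, _, _, rfl, hxu, huw⟩
  · rintro ⟨x, w, rfl, hx, u, v, rfl, hxu, hxv⟩
    exact ⟨x, u, v, rfl, (hr' _).2 ⟨x, u, rfl, hx, hxu⟩, (hs' _).2 ⟨x, v, rfl, hx, hxv⟩⟩

theorem Good.isLocal_diff {p : ZFSet.{0}} (hp : Good p) (hρ : IsLocal p ρ) (hσ : IsLocal p σ) :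
    IsLocal p fun x w => ρ x w ∧ ¬ σ x w := by
  intro n
  obtain ⟨m, r, hr, hr'⟩ := hρ n
  obtain ⟨k, s, hs, hs'⟩ := hσ n
  refine ⟨_, _, hp.diff_mem_level (n := m + k) (hp.level_mono (by omega) hr)
    (hp.level_mono (by omega) hs), fun z => ?_⟩
  rw [ZFSet.mem_sdiff, hr', hs']
  constructor
  · rintro ⟨⟨x, w, rfl, hx, h⟩, k⟩
    exact ⟨x, w, rfl, hx, h, fun h' => k ⟨x, w, rfl, hx, h'⟩⟩
  · rintro ⟨x, w, rfl, hx, h, k⟩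
    refine ⟨⟨x, w, rfl, hx, h⟩, ?_⟩
    rintro ⟨x', w', e, -, h'⟩
    obtain ⟨rfl, rfl⟩ := ZFSet.pair_injective e
    exact k h'

theorem Good.isLocal_or {p : ZFSet.{0}} (hp : Good p) (hρ : IsLocal p ρ) (hσ : IsLocal p σ) :
    IsLocal p fun x w => ρ x w ∨ σ x w := by
  intro n
  obtain ⟨m, r, hr, hr'⟩ := hρ n
  obtain ⟨k, s, hs, hs'⟩ := hσ n
  have hr := hp.level_mono (show m ≤ m + k by omega) hr
  have hs := hp.level_mono (show k ≤ m + k by omega) hs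
  have hl := hp.level_mem_level (m + k)
  -- Binary union is not a basic operation; it is obtained by complementing twice within a level
  -- that includes both sets.
  have h := hp.diff_mem_level (hp.level_mono (by omega) hl) (hp.diff_mem_level
    (hp.diff_mem_level hl (hp.level_mono (by omega) hr)) (hp.level_mono (by omega) hs))
  refine ⟨_, _, h, fun z => ?_⟩
  have key : z ∈ level p (m + k) \ ((level p (m + k) \ r) \ s) ↔ z ∈ r ∨ z ∈ s := by
    simp only [ZFSet.mem_sdiff]
    have h1 : z ∈ r → z ∈ level p (m + k) := fun h => hp.subset_level hr h
    have h2 : z ∈ s → z ∈ level p (m + k) := fun h => hp.subset_level hs h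
    tauto
  rw [key, hr', hs']
  constructor
  · rintro (⟨x, w, rfl, hx, h⟩ | ⟨x, w, rfl, hx, h⟩)
    exacts [⟨x, w, rfl, hx, .inl h⟩, ⟨x, w, rfl, hx, .inr h⟩]
  · rintro ⟨x, w, rfl, hx, h | h⟩
    exacts [.inl ⟨x, w, rfl, hx, h⟩, .inr ⟨x, w, rfl, hx, h⟩]

/-- The set related to `x` is the section at `x` of the set representing `ρ`, and these sections all
appear one level later. This passes from describing the elements of a value to describing the value.
-/
theorem Good.isLocal_graph {p : ZFSet.{0}} (hp : Good p) (hρ : IsLocal p ρ) :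
    IsLocal p fun x w => ∀ u, u ∈ w ↔ ρ x u := by
  intro n
  obtain ⟨m, r, hr, hr'⟩ := hρ n
  obtain ⟨-, h⟩ := hp.op_mem_level (n := m + n + 3) (B := fun _ x y => graphRel x y)
    (by simp [ops]) (hp.level_mono (by omega) hr)
    (hp.level_mono (by omega) (hp.level_mem_level n)) fun _ z hz => by
      obtain ⟨x, rfl, hx⟩ := mem_graphRel.1 hz
      have hx' := hp.level_mono (show n ≤ m + n + 1 by omega) hx
      exact hp.pair_mem_level hx' (hp.sect_mem_level (n := m + n)
        (hp.level_mono (by omega) hr) (hp.level_mono (by omega) hx))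
  have hsect : ∀ x u, x ∈ level p n → (u ∈ sect r x ↔ ρ x u) := by
    intro x u hx
    rw [mem_sect, hr']
    constructor
    · rintro ⟨x', u', e, -, h⟩
      obtain ⟨rfl, rfl⟩ := ZFSet.pair_injective e
      exact h
    · exact fun h => ⟨x, u, rfl, hx, h⟩
  refine ⟨_, _, h, fun z => ?_⟩
  rw [mem_graphRel]
  constructor
  · rintro ⟨x, rfl, hx⟩
    exact ⟨x, _, rfl, hx, fun u => hsect x u hx⟩
  · rintro ⟨x, w, rfl, hx, hw⟩
    refine ⟨x, ?_, hx⟩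
    congr 1
    ext u
    rw [hw, hsect x u hx]

/-- The code of a tuple. -/
noncomputable def code : {n : ℕ} → (Fin n → ZFSet.{0}) → ZFSet.{0}
  | 0, _ => ∅
  | _ + 1, v => ZFSet.pair (v 0) (code (Fin.tail v))

/-- A function on tuples is local if it is represented by a local relation on codes. -/
def LocalFun (p : ZFSet.{0}) {n : ℕ} (F : (Fin n → ZFSet.{0}) → ZFSet.{0}) : Prop :=
  ∃ ρ, IsLocal p ρ ∧ ∀ v w, ρ (code v) w ↔ w = F v

theorem Good.localFun_proj {p : ZFSet.{0}} (hp : Good p)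
    {n : ℕ} (i : Fin n) : LocalFun p (fun v => v i) := by
  induction n with
  | zero => exact i.elim0
  | succ n ih =>
    refine Fin.cases ?_ (fun i => ?_) i
    · refine ⟨_, hp.isLocal_fst, fun v w => ?_⟩
      simp only [code]
      constructor
      · rintro ⟨u, h⟩
        exact (ZFSet.pair_injective h).1.symm
      · rintro rfl
        exact ⟨_, rfl⟩
    · obtain ⟨ρ, hρ, h⟩ := ih i
      refine ⟨_, hp.isLocal_comp hp.isLocal_snd hρ, fun v w => ?_⟩
      simp only [code]
      constructor
      · rintro ⟨u, ⟨u', e⟩, k⟩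
        obtain ⟨rfl, rfl⟩ := ZFSet.pair_injective e
        exact (h _ _).1 k
      · rintro rfl
        exact ⟨_, ⟨_, rfl⟩, (h _ _).2 rfl⟩

theorem Good.localFun_of_mem {p : ZFSet.{0}} (hp : Good p)
    {n : ℕ} {F : (Fin n → ZFSet.{0}) → ZFSet.{0}}
    (hρ : IsLocal p ρ) (h : ∀ v w, ρ (code v) w ↔ w ∈ F v) : LocalFun p F :=
  ⟨_, hp.isLocal_graph hρ, fun v w => by simp only [h, ZFSet.ext_iff]⟩

theorem LocalFun.exists_mem {p : ZFSet.{0}} {n : ℕ}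
    {F : (Fin n → ZFSet.{0}) → ZFSet.{0}} (hF : LocalFun p F) (hp : Good p) :
    ∃ ρ, IsLocal p ρ ∧ ∀ v w, ρ (code v) w ↔ w ∈ F v := by
  obtain ⟨ρ, hρ, h⟩ := hF
  exact ⟨_, hp.isLocal_comp hρ hp.isLocal_mem, fun v w => by simp [h]⟩

theorem Good.localFun_code {p : ZFSet.{0}} (hp : Good p)
    {n k : ℕ} {H : Fin k → (Fin n → ZFSet.{0}) → ZFSet.{0}}
    (hH : ∀ i, LocalFun p (H i)) : LocalFun p (fun v => code (fun i => H i v)) := by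
  induction k with
  | zero =>
    -- The empty code has no elements, so the always false relation, a difference of equals,
    -- describes it.
    refine hp.localFun_of_mem (hp.isLocal_diff hp.isLocal_mem hp.isLocal_mem) fun v w => ?_
    simp [code]
  | succ k ih =>
    obtain ⟨ρ, hρ, h⟩ := hH 0
    obtain ⟨σ, hσ, h'⟩ := ih (fun i => hH i.succ)
    refine ⟨_, hp.isLocal_fork hρ hσ, fun v w => ?_⟩
    simp only [h, h', code]
    constructor
    · rintro ⟨u, u', rfl, rfl, rfl⟩
      rfl
    · rintro rfl
      exact ⟨_, _, rfl, rfl, rfl⟩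

theorem Good.localFun {p : ZFSet.{0}} (hp : Good p)
    {n : ℕ} {F : (Fin n → ZFSet.{0}) → ZFSet.{0}} (hF : Rudimentary F) :
    LocalFun p F := by
  induction hF with
  | proj i => exact hp.localFun_proj i
  | pair i j =>
    obtain ⟨ρ, hρ, h⟩ := hp.localFun_proj i
    obtain ⟨σ, hσ, h'⟩ := hp.localFun_proj j
    exact hp.localFun_of_mem (hp.isLocal_or hρ hσ) fun v w => by simp [h, h']
  | diff i j =>
    obtain ⟨ρ, hρ, h⟩ := (hp.localFun_proj i).exists_mem hp
    obtain ⟨σ, hσ, h'⟩ := (hp.localFun_proj j).exists_mem hp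
    exact hp.localFun_of_mem (hp.isLocal_diff hρ hσ) fun v w => by simp [h, h']
  | comp hG hH ihG ihH =>
    obtain ⟨ρ, hρ, h⟩ := ihG
    obtain ⟨σ, hσ, h'⟩ := hp.localFun_code ihH
    exact ⟨_, hp.isLocal_comp hσ hρ, fun v w => by simp [h, h']⟩
  | @union n H hH ih =>
    obtain ⟨ρ, hρ, h⟩ := ih.exists_mem hp
    -- From a code `⟨x, t⟩` the fork leads to every `⟨y, t⟩` with `y ∈ x`; then `ρ` lists the
    -- elements of `H` there.
    have step := hp.isLocal_comp (hp.isLocal_fork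
      (hp.isLocal_comp hp.isLocal_fst hp.isLocal_mem) hp.isLocal_snd) hρ
    refine hp.localFun_of_mem step fun v w => ?_
    have hupd : ∀ y, ZFSet.pair y (code (Fin.tail v)) = code (Function.update v 0 y) := by
      intro y
      simp [code]
    simp only [ZFSet.mem_iUnion, Subtype.exists, code]
    constructor
    · rintro ⟨u, ⟨y, t, rfl, ⟨a, ⟨b, e⟩, hy⟩, ⟨c, e'⟩⟩, hu⟩
      obtain ⟨rfl, rfl⟩ := ZFSet.pair_injective e
      obtain ⟨rfl, rfl⟩ := ZFSet.pair_injective e'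
      rw [hupd, h] at hu
      exact ⟨y, hy, hu⟩
    · rintro ⟨y, hy, hw⟩
      exact ⟨_, ⟨y, _, rfl, ⟨_, ⟨_, rfl⟩, hy⟩, ⟨_, rfl⟩⟩, by rw [hupd, h]; exact hw⟩

/-! ### The levels exhaust the rudimentary closure -/

theorem Good.empty_mem_level {p : ZFSet.{0}} (hp : Good p) : ∃ n, ∅ ∈ level p n := by
  have h := hp.diff_mem_level (hp.level_mem_level 0) (hp.level_mem_level 0)
  have e : level p 0 \ level p 0 = ∅ := by ext; simp
  exact ⟨_, e ▸ h⟩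

theorem Good.code_mem_level {p : ZFSet.{0}} (hp : Good p)
    {n : ℕ} (v : Fin n → ZFSet.{0}) (hv : ∀ i, ∃ m, v i ∈ level p m) :
    ∃ m, code v ∈ level p m := by
  induction n with
  | zero => exact hp.empty_mem_level
  | succ n ih =>
    obtain ⟨m, hm⟩ := hv 0
    obtain ⟨k, hk⟩ := ih (Fin.tail v) fun i => hv i.succ
    exact ⟨_, hp.pair_mem_level (n := m + k) (hp.level_mono (by omega) hm)
      (hp.level_mono (by omega) hk)⟩

theorem Good.rudimentary_mem_level {p : ZFSet.{0}} (hp : Good p)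
    {n : ℕ} {F : (Fin n → ZFSet.{0}) → ZFSet.{0}}
    (hF : Rudimentary F) (v : Fin n → ZFSet.{0}) (hv : ∀ i, ∃ m, v i ∈ level p m) :
    ∃ m, F v ∈ level p m := by
  obtain ⟨ρ, hρ, h⟩ := hp.localFun hF
  obtain ⟨n, hn⟩ := hp.code_mem_level v hv
  obtain ⟨m, r, hr, hr'⟩ := hρ n
  exact ⟨m, hp.right_mem_level (hp.subset_level hr
    ((hr' _).2 ⟨code v, F v, rfl, hn, (h _ _).2 rfl⟩))⟩

theorem tower_mem {p J : ZFSet.{0}} (hJ : RudClosed J) (hpJ : p ∈ J) (n : ℕ) :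
    AnalysisJ2.tower p n ∈ J := by
  induction n with
  | zero => exact hpJ
  | succ n ih => rw [tower_succ]; exact hJ.rud1 (.step (.proj 0)) ih

theorem Good.level_subset {p : ZFSet.{0}} (hp : Good p)
    {J : ZFSet.{0}} (hJ : RudClosed J) (hpJ : p ∈ J) (hd : dom p ⊆ J)
    (n : ℕ) : level p n ⊆ J := by
  induction n with
  | zero => exact hd
  | succ n ih =>
    rw [level, tower_succ]
    exact hJ.dom_step_subset (hp.tower n) (AnalysisJ2.tower_mem hJ hpJ n) ih

theorem Good.mem_rudClosure_iff {p : ZFSet.{0}} (hp : Good p)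
    {x : ZFSet.{0}} (hx : ∃ n, x ∈ level p n)
    (hpJ : p ∈ rudClosure x) (hd : dom p ⊆ rudClosure x) {z : ZFSet.{0}} :
    z ∈ rudClosure x ↔ ∃ n, z ∈ level p n := by
  constructor
  · intro hz
    have h := mem_rudClosure.1 hz
    clear hz
    induction h with
    | mem hz => obtain ⟨n, hn⟩ := hx; exact ⟨n, hp.subset_level hn hz⟩
    | self => exact hx
    | app hF v hv ih => exact hp.rudimentary_mem_level hF v ih
  · rintro ⟨n, hn⟩
    exact hp.level_subset (isLeast_rudClosure x).1.2.2 hpJ hd n hn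

end Local

/-! ### Certificates for the union of the tower -/

/-- `C` contains with each element other than `p` the element of the tower that precedes it. -/
def IsChain (p C : ZFSet.{0}) : Prop :=
  ∀ d ∈ C, d = p ∨ ∃ d' ∈ C, d = step d' ∧ dom d' ∈ dom d

/-- `C` certifies that `z` belongs to the union of the tower over `p`. -/
def Cert (p C z : ZFSet.{0}) : Prop := IsChain p C ∧ ∃ d ∈ C, z ∈ d

/-- The union of the tower over `p`. -/
def towerUnion (p : ZFSet.{0}) : Set ZFSet.{0} := {z | ∃ n, z ∈ tower p n}

/-- The clause `dom d' ∈ dom d` makes the descent through predecessors well-founded, so it ends at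
`p` without any mention of natural numbers inside the certificate. -/
theorem IsChain.exists_tower {p C : ZFSet.{0}} (hC : IsChain p C) {d : ZFSet.{0}} (hd : d ∈ C) :
    ∃ n, d = tower p n := by
  induction d using (InvImage.wf dom ZFSet.mem_wf).induction with
  | _ d ih =>
    rcases hC d hd with rfl | ⟨d', hd', rfl, h⟩
    · exact ⟨0, rfl⟩
    · obtain ⟨n, rfl⟩ := ih d' h hd'
      exact ⟨n + 1, (tower_succ p n).symm⟩

theorem Good.exists_isChain {p : ZFSet.{0}} (hp : Good p) {J : ZFSet.{0}} (hJ : RudClosed J)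
    (hpJ : p ∈ J) (n : ℕ) : ∃ C ∈ J, IsChain p C ∧ AnalysisJ2.tower p n ∈ C := by
  induction n with
  | zero =>
    refine ⟨{p}, hJ.rud1 (.singleton (.proj 0)) hpJ, fun d hd => .inl (by simpa using hd), ?_⟩
    simp [AnalysisJ2.tower]
  | succ n ih =>
    obtain ⟨C, hC, hch, hn⟩ := ih
    have ht := tower_mem hJ hpJ (n + 1)
    refine ⟨C ∪ {AnalysisJ2.tower p (n + 1)},
      hJ.rud3 (B := fun x y _ => x ∪ {y}) (.sup (.proj 0) (.singleton (.proj 1))) hC ht ht,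
      fun d hd => ?_, by simp⟩
    rcases ZFSet.mem_union.1 hd with hd | hd
    · rcases hch d hd with h | ⟨d', hd', h⟩
      · exact .inl h
      · exact .inr ⟨d', ZFSet.mem_union.2 (.inl hd'), h⟩
    · rw [ZFSet.mem_singleton] at hd
      subst hd
      exact .inr ⟨_, ZFSet.mem_union.2 (.inl hn), tower_succ p n, hp.level_mem_level n⟩

theorem Good.mem_towerUnion_iff {p : ZFSet.{0}} (hp : Good p) {J : ZFSet.{0}} (hJ : RudClosed J)
    (hpJ : p ∈ J) (hd : dom p ⊆ J) {z : ZFSet.{0}} :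
    z ∈ towerUnion p ↔ z ∈ J ∧ ∃ C ∈ J, Cert p C z := by
  constructor
  · rintro ⟨n, hn⟩
    constructor
    · obtain ⟨a, ha, b, hb, rfl⟩ := (hp.tower n).pairs z hn
      have hl := hp.level_subset hJ hpJ hd n
      exact hJ.rud3 (B := fun x y _ => ZFSet.pair x y) (.opair (.proj 0) (.proj 1))
        (hl ha) (hl hb) (hl hb)
    · obtain ⟨C, hC, hch, h⟩ := hp.exists_isChain hJ hpJ n
      exact ⟨C, hC, hch, _, h, hn⟩
  · rintro ⟨-, C, -, hC, d, hd, hz⟩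
    obtain ⟨n, rfl⟩ := hC.exists_tower hd
    exact ⟨n, hz⟩

theorem RudRel.cert {n : ℕ} (i j k : Fin n) :
    RudRel (fun v : Fin n → ZFSet.{0} => Cert (v i) (v j) (v k)) := by
  refine .and (.ball (.proj j) (.or (.eq (.proj 0) (.proj i.succ)) (.bex (.proj j.succ)
    (.and (.eq (.proj 1) (.step (.proj 0))) (.mem (.dom (.proj 0)) (.dom (.proj 1)))))))
    (.bex (.proj j) (.mem (.proj k.succ) (.proj 0)))

/-- Since `J ∈ K`, the search for a certificate is bounded by a parameter from `K`, and rudimentary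
separation applies. -/
theorem Good.exists_mem_eq_towerUnion {p J K : ZFSet.{0}} (hp : Good p) (hJ : RudClosed J)
    (hpJ : p ∈ J) (hd : dom p ⊆ J) (hK : RudClosed K) (hJK : J ∈ K) (hpK : p ∈ K) :
    ∃ W ∈ K, (W : Set ZFSet.{0}) = towerUnion p := by
  refine ⟨bUnion J fun z => guard (∃ C ∈ J, Cert p C z) {z}, ?_, ?_⟩
  · exact hK.rud3 (B := fun p J _ => bUnion J fun z => guard (∃ C ∈ J, Cert p C z) {z})
      (.bUnion (.proj 1) (.guard (.bex (.proj 2) (.cert 2 0 1)) (.singleton (.proj 0))))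
      hpK hJK hJK
  · ext z
    rw [hp.mem_towerUnion_iff hJ hpJ hd]
    simp only [SetLike.mem_coe, mem_bUnion, mem_guard, ZFSet.mem_singleton]
    grind

/-! ### The union of the tower is a well-ordering -/

/-- End extension: an element gains no predecessors after the stage at which it appears. Every
comparison in the union can thus be decided at one stage. -/
theorem Good.mem_tower_of_mem_towerUnion {p a b : ZFSet.{0}} (hp : Good p) {n : ℕ}
    (h : ZFSet.pair a b ∈ towerUnion p) (hb : b ∈ level p n) :
    ZFSet.pair a b ∈ AnalysisJ2.tower p n := by
  obtain ⟨m, hm⟩ := h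
  have h1 := (hp.endExtends_tower (le_max_left m n)).subset hm
  exact (hp.endExtends_tower (le_max_right m n)).mem a b hb h1

theorem Good.wellOrders_towerUnion {p : ZFSet.{0}} (hp : Good p) :
    WellOrders (towerUnion p) {z | ∃ n, z ∈ level p n} where
  refl := by
    rintro a ⟨n, hn⟩
    exact ⟨n, (hp.tower n).wo.refl a hn⟩
  antisymm := by
    rintro a ⟨n, hn⟩ b ⟨m, hm⟩ h k
    have ha := hp.level_mono (le_max_left n m) hn
    have hb := hp.level_mono (le_max_right n m) hm
    exact (hp.tower (max n m)).wo.antisymm a ha b hb (hp.mem_tower_of_mem_towerUnion h hb)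
      (hp.mem_tower_of_mem_towerUnion k ha)
  trans := by
    rintro a - b ⟨m, hm⟩ c ⟨k, hk⟩ hab hbc
    have hb := hp.level_mono (le_max_left m k) hm
    have hc := hp.level_mono (le_max_right m k) hk
    have hab := hp.mem_tower_of_mem_towerUnion hab hb
    exact ⟨max m k, (hp.tower _).wo.trans a ((hp.tower _).left_mem hab) b hb c hc hab
      (hp.mem_tower_of_mem_towerUnion hbc hc)⟩
  total := by
    rintro a ⟨n, hn⟩ b ⟨m, hm⟩
    have ha := hp.level_mono (le_max_left n m) hn
    have hb := hp.level_mono (le_max_right n m) hm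
    exact ((hp.tower (max n m)).wo.total a ha b hb).imp (fun h => ⟨_, h⟩) fun h => ⟨_, h⟩
  exists_least := by
    rintro S hS ⟨s, hs⟩
    obtain ⟨n, hn⟩ := hS hs
    obtain ⟨a, ⟨haS, han⟩, hmin⟩ := (hp.tower n).wo.exists_least {z | z ∈ S ∧ z ∈ level p n}
      (fun z hz => hz.2) ⟨s, hs, hn⟩
    refine ⟨a, haS, fun b hb => ?_⟩
    obtain ⟨m, hm⟩ := hS hb
    have ha := hp.level_mono (le_max_left n m) han
    have hb' := hp.level_mono (le_max_right n m) hm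
    rcases (hp.tower (max n m)).wo.total a ha b hb' with h | h
    · exact ⟨_, h⟩
    -- Anything below `a` already lies in level `n`, so minimality there is minimality in all of
    -- `S`.
    · have h := hp.mem_tower_of_mem_towerUnion ⟨_, h⟩ han
      exact ⟨n, hmin b ⟨hb, (hp.tower n).left_mem h⟩⟩

/-! ### Definability over transitive sets closed under rudimentary functions -/

section Definability

open Set FirstOrder

variable {J : ZFSet.{0}} {α : Type}

theorem definable_mem {f g : (α → J) → J}
    (hf : (univ : Set J).DefinableFun setLanguage f)
    (hg : (univ : Set J).DefinableFun setLanguage g) :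
    (univ : Set J).Definable setLanguage {v | (f v : ZFSet.{0}) ∈ (g v : ZFSet.{0})} := by
  have h : (univ : Set J).Definable setLanguage
      {v : Fin 2 → J | (v 0 : ZFSet.{0}) ∈ (v 1 : ZFSet.{0})} := by
    refine Definable.mono (A := ∅) ?_ (empty_subset _)
    rw [empty_definable_iff]
    refine ⟨(memSymb.formula₂ (Language.Term.var 0) (Language.Term.var 1)), ?_⟩
    ext v
    simp only [mem_ofPred_eq, Language.Formula.realize_rel₂]
    rfl
  have hF : (univ : Set J).DefinableMap setLanguage (fun v => ![f v, g v]) := by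
    simp [DefinableMap, *]
  exact h.preimage_map hF

theorem definable_ex {P : (α → J) → J → Prop} [Finite α]
    (h : (univ : Set J).Definable setLanguage
      {w : Option α → J | P (fun i => w (some i)) (w none)}) :
    (univ : Set J).Definable setLanguage {v : α → J | ∃ y, P v y} := by
  convert h.image_comp_embedding Function.Embedding.some using 1
  ext v
  simp only [mem_ofPred_eq, mem_image]
  constructor
  · rintro ⟨y, hy⟩
    exact ⟨fun o => o.elim y v, hy, rfl⟩
  · rintro ⟨w, hw, rfl⟩
    exact ⟨w none, hw⟩

theorem definable_all {P : (α → J) → J → Prop} [Finite α]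
    (h : (univ : Set J).Definable setLanguage
      {w : Option α → J | P (fun i => w (some i)) (w none)}) :
    (univ : Set J).Definable setLanguage {v : α → J | ∀ y, P v y} := by
  have := (definable_ex (P := fun v y => ¬ P v y) h.compl).compl
  convert this using 1
  ext v
  simp

theorem definable_imp {P Q : (α → J) → Prop}
    (hP : (univ : Set J).Definable setLanguage {v | P v})
    (hQ : (univ : Set J).Definable setLanguage {v | Q v}) :
    (univ : Set J).Definable setLanguage {v | P v → Q v} := by
  convert hP.compl.union hQ using 1
  ext v
  simp [imp_iff_not_or]

/-- Elements of a transitive `J` are determined by their members in `J`, so the graph is defined by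
quantifying over `J`. -/
theorem definableFun_of_mem [Finite α] (ht : J.IsTransitive) {f : (α → J) → J}
    (h : (univ : Set J).Definable setLanguage
      {w : Option α → J | (w none : ZFSet.{0}) ∈ (f fun i => w (some i) : ZFSet.{0})}) :
    (univ : Set J).DefinableFun setLanguage f := by
  have h1 : (univ : Set J).Definable setLanguage {w : Option (Option α) → J |
      (w none : ZFSet.{0}) ∈ (w (some none) : ZFSet.{0})} := definable_mem (.proj _) (.proj _)
  have h2 : (univ : Set J).Definable setLanguage {w : Option (Option α) → J |
      (w none : ZFSet.{0}) ∈ (f fun i => w (some (some i)) : ZFSet.{0})} :=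
    h.preimage_comp (fun o : Option α => o.elim none fun i => some (some i))
  have := definable_all (P := fun (w : Option α → J) u => ((u : ZFSet.{0}) ∈ (w none : ZFSet.{0}) ↔
    (u : ZFSet.{0}) ∈ (f fun i => w (some i) : ZFSet.{0}))) (by
      convert (definable_imp h1 h2).inter (definable_imp h2 h1) using 1
      ext w
      exact iff_iff_implies_and_implies)
  unfold DefinableFun
  convert this using 1
  ext w
  simp only [mem_ofPred_eq]
  change (f fun i => w (some i)) = w none ↔ _
  rw [Subtype.ext_iff, ZFSet.ext_iff]
  constructor
  · exact fun h u => (h u).symm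
  · exact fun h z => ⟨fun hz => (h ⟨z, ht _ (Subtype.property _) hz⟩).2 hz,
      fun hz => (h ⟨z, ht _ (Subtype.property _) hz⟩).1 hz⟩

/-- The restriction to `J` of a function on tuples. -/
noncomputable def lift (hJ : RudClosed J) {n : ℕ} {F : (Fin n → ZFSet.{0}) → ZFSet.{0}}
    (hF : Rudimentary F) (v : Fin n → J) : J :=
  ⟨F fun i => v i, hJ hF _ fun i => (v i).2⟩

theorem definableFun_lift (hJ : RudClosed J) (ht : J.IsTransitive) {n : ℕ}
    {F : (Fin n → ZFSet.{0}) → ZFSet.{0}} (hF : Rudimentary F) :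
    (univ : Set J).DefinableFun setLanguage (lift hJ hF) := by
  induction hF with
  | proj i => exact (.proj _)
  | pair i j =>
    refine definableFun_of_mem ht ?_
    convert (DefinableFun.ofPred_eq (L := setLanguage) (A := (univ : Set J))
      (f := fun w => w none) (g := fun w => w (some i)) (.proj _) (.proj _)).union
      (DefinableFun.ofPred_eq (f := fun w => w none) (g := fun w => w (some j))
        (.proj _) (.proj _)) using 1
    ext w
    simp only [lift, mem_ofPred_eq, mem_union, ZFSet.mem_pair, Subtype.ext_iff]
  | diff i j =>
    refine definableFun_of_mem ht ?_
    convert (definable_mem (J := J) (f := fun w => w none) (g := fun w => w (some i))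
      (.proj _) (.proj _)).inter (definable_mem (f := fun w => w none)
      (g := fun w => w (some j)) (.proj _) (.proj _)).compl using 1
    ext w
    simp [lift]
  | comp hG hH ihG ihH =>
    exact DefinableFun.comp (g := fun v i => lift hJ (hH i) v) ihH ihG
  | @union n H hH ih =>
    refine definableFun_of_mem ht ?_
    have h1 : (univ : Set J).Definable setLanguage {w : Option (Option (Fin (n + 1))) → J |
        (w none : ZFSet.{0}) ∈ (w (some (some 0)) : ZFSet.{0})} := definable_mem (.proj _) (.proj _)
    have h2 : (univ : Set J).Definable setLanguage {w : Option (Option (Fin (n + 1))) → J |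
        (w (some none) : ZFSet.{0}) ∈ (lift hJ hH
          (Function.update (fun i => w (some (some i))) 0 (w none)) : ZFSet.{0})} := by
      refine definable_mem (g := fun w => lift hJ hH
          (Function.update (fun i => w (some (some i))) 0 (w none))) (.proj _)
        (DefinableFun.comp (fun i => ?_) ih)
      by_cases h : i = 0
      · subst h
        simpa using DefinableFun.proj _
      · simpa [Function.update_of_ne h] using DefinableFun.proj _
    convert definable_ex (P := fun (w : Option (Fin (n + 1)) → J) y =>
      (y : ZFSet.{0}) ∈ (w (some 0) : ZFSet.{0}) ∧ (w none : ZFSet.{0}) ∈ (lift hJ hH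
          (Function.update (fun i => w (some i)) 0 y) : ZFSet.{0})) (h1.inter h2) using 1
    ext w
    have e : ∀ y : J, (fun i => ((Function.update (fun i => w (some i)) 0 y : Fin (n + 1) → J) i :
        ZFSet.{0})) = Function.update (fun i => (w (some i) : ZFSet.{0})) 0 y := by
      intro y
      funext i
      by_cases h : i = 0
      · subst h; simp
      · simp [Function.update_of_ne h]
    simp only [lift, mem_ofPred_eq, ZFSet.mem_iUnion, e, Subtype.exists]
    constructor
    · rintro ⟨y, hy, h⟩
      exact ⟨y, ht _ (w (some 0)).2 hy, hy, h⟩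
    · rintro ⟨y, -, hy, h⟩
      exact ⟨y, hy, h⟩

theorem RudRel.definable (hJ : RudClosed J) (ht : J.IsTransitive) {n : ℕ}
    {P : (Fin n → ZFSet.{0}) → Prop} (hP : RudRel P) :
    (univ : Set J).Definable setLanguage {v : Fin n → J | P fun i => v i} := by
  obtain ⟨F, hF, h⟩ := hP
  have hf := definableFun_lift hJ ht hF
  have := definable_ex (P := fun (v : Fin n → J) u => (u : ZFSet.{0}) ∈ (lift hJ hF v : ZFSet.{0}))
    (definable_mem (g := fun w => lift hJ hF fun i => w (some i)) (.proj _)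
      (DefinableFun.comp (fun i => (.proj _)) hf))
  convert this using 1
  ext v
  simp only [mem_ofPred_eq, h, lift, Subtype.exists]
  exact ⟨fun ⟨u, hu⟩ => ⟨u, ht _ (hJ hF _ fun i => (v i).2) hu, hu⟩, fun ⟨u, _, hu⟩ => ⟨u, hu⟩⟩

end Definability

/-! ### Construction of a universal well-ordering -/

-- Here the certificate is sought by an unbounded quantifier over `J`, with `p` as a parameter; this
-- gives definability without making the union an element of `J`.
open Set in
theorem Good.isDefinableSubset_towerUnion {p J : ZFSet.{0}} (hp : Good p) (hJ : RudClosed J)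
    (ht : J.IsTransitive) (hpJ : p ∈ J) (hd : dom p ⊆ J) :
    IsDefinableSubset J (towerUnion p) := by
  refine ⟨{z | ∃ C : J, Cert p C z}, ?_, ?_⟩
  · refine definable_ex (α := Fin 1) (P := fun v C => Cert p C (v 0)) ?_
    refine ((RudRel.cert 0 1 2).definable hJ ht).preimage_map
      (F := fun w : Option (Fin 1) → J => ![⟨p, hpJ⟩, w none, w (some 0)]) fun i => ?_
    fin_cases i
    · exact setLanguage.definableFun_const _ (mem_univ _)
    · exact .proj _
    · exact .proj _
  · ext z
    rw [hp.mem_towerUnion_iff hJ hpJ hd]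
    simp only [Set.mem_image, mem_ofPred_eq, Subtype.exists]
    grind

theorem rudClosed_J2 : RudClosed J2 := (isLeast_rudClosure J1).1.2.2

theorem Good.isTransitive_J2 {p : ZFSet.{0}} (hp : Good p) (hpJ : p ∈ J2)
    (hd : dom p ⊆ J2) (hJ1 : ∃ n, J1 ∈ level p n) : J2.IsTransitive := fun z hz t ht => by
  obtain ⟨n, hn⟩ := (hp.mem_rudClosure_iff hJ1 hpJ hd).1 hz
  exact (hp.mem_rudClosure_iff hJ1 hpJ hd).2 ⟨n, hp.subset_level hn ht⟩

theorem Good.isUniversalWellOrdering {p : ZFSet.{0}} (hp : Good p) (hpJ : p ∈ J2)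
    (hd : dom p ⊆ J2) (hJ1 : ∃ n, J1 ∈ level p n) : IsUniversalWellOrdering (towerUnion p) := by
  have hJ := rudClosed_J2
  have hmem : ∀ {z}, z ∈ J2 ↔ ∃ n, z ∈ level p n := hp.mem_rudClosure_iff hJ1 hpJ hd
  have ht := hp.isTransitive_J2 hpJ hd hJ1
  have hset : (J2 : Set ZFSet.{0}) = {z | ∃ n, z ∈ level p n} := by
    ext z
    exact hmem
  have hlevel : ∀ n, level p n ∈ J2 := fun n => hmem.2 ⟨_, hp.level_mem_level n⟩
  have hwo : WellOrders (towerUnion p) (J2 : Set ZFSet.{0}) := hset ▸ hp.wellOrders_towerUnion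
  refine ⟨⟨⟨hp.isDefinableSubset_towerUnion hJ ht hpJ hd, ?_⟩, ?_⟩, hwo, ?_, ?_⟩
  · rintro Y ⟨y, hy, rfl⟩
    obtain ⟨n, hn⟩ := hmem.1 hy
    have htn := tower_mem hJ hpJ n
    -- A pair in `y` has its right coordinate in level `n`, so stage `n` decides whether it belongs
    -- to the union.
    refine ⟨AnalysisJ2.tower p n ∩ y,
      hJ.rud3 (B := fun x y _ => x ∩ y) (.inf (.proj 0) (.proj 1)) htn hy hy, ?_⟩
    ext z
    simp only [SetLike.mem_coe, ZFSet.mem_inter, Set.mem_inter_iff]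
    refine and_congr_left fun hz => ⟨fun h => ⟨n, h⟩, fun h => ?_⟩
    obtain ⟨m, hm⟩ := h
    obtain ⟨a, -, b, -, rfl⟩ := (hp.tower m).pairs z hm
    exact hp.mem_tower_of_mem_towerUnion ⟨m, hm⟩ (hp.right_mem_level (hp.subset_level hn hz))
  · rintro z ⟨n, hn⟩
    obtain ⟨a, ha, b, hb, rfl⟩ := (hp.tower n).pairs z hn
    exact ⟨a, hmem.2 ⟨n, ha⟩, b, hmem.2 ⟨n, hb⟩, rfl⟩
  · rintro S ⟨hS, hinit⟩
    obtain ⟨c₀, hc₀, hc₀S⟩ := Set.exists_of_ssubset hS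
    obtain ⟨c, ⟨hc, hcS⟩, hmin⟩ := hwo.exists_least {z | z ∈ J2 ∧ z ∉ S} (fun z hz => hz.1)
      ⟨c₀, hc₀, hc₀S⟩
    obtain ⟨n, hn⟩ := hmem.1 hc
    -- `S` consists of the strict predecessors of `c`, the least element outside it; all of them lie
    -- in level `n` with `c`.
    refine ⟨bUnion (level p n) fun b =>
      guard (ZFSet.pair b c ∈ AnalysisJ2.tower p n ∧ ¬ b = c) {b}, ?_, ?_⟩
    · exact hJ.rud3 (B := fun A W c => bUnion A fun b =>
        guard (ZFSet.pair b c ∈ W ∧ ¬ b = c) {b}) (.bUnion (.proj 0) (.guard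
          (.and (.mem (.opair (.proj 0) (.proj 3)) (.proj 2)) (.not (.eq (.proj 0) (.proj 3))))
          (.singleton (.proj 0)))) (hlevel n) (tower_mem hJ hpJ n) hc
    · ext b
      simp only [SetLike.mem_coe, mem_bUnion, mem_guard, ZFSet.mem_singleton]
      constructor
      · rintro ⟨b, hb, rfl, hbc, hne⟩
        by_contra hbS
        have hbJ := hmem.2 ⟨n, hb⟩
        exact hne (hwo.antisymm _ hbJ c hc ⟨n, hbc⟩ (hmin _ ⟨hbJ, hbS⟩))
      · intro hbS
        have hbJ := hS.1 hbS
        have hbc : ZFSet.pair b c ∈ towerUnion p :=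
          (hwo.total b hbJ c hc).resolve_right fun h => hcS (hinit b hbS c hc h)
        have hbc := hp.mem_tower_of_mem_towerUnion hbc hn
        refine ⟨b, (hp.tower n).left_mem hbc, rfl, hbc, ?_⟩
        rintro rfl
        exact hcS hbS
  · rintro Y ⟨y, hy, rfl⟩
    obtain ⟨n, hn⟩ := hmem.1 hy
    refine ⟨(level p n : Set ZFSet.{0}), ⟨⟨fun z hz => hmem.2 ⟨n, hz⟩, fun h => ?_⟩, ?_⟩,
      fun z hz => hp.subset_level hn hz⟩
    · exact ZFSet.mem_irrefl _ (h (hlevel n))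
    · intro a ha b _ h
      exact (hp.tower n).left_mem (hp.mem_tower_of_mem_towerUnion h ha)

theorem dom_singleton_pair (a b : ZFSet.{0}) : dom {ZFSet.pair a b} = {a} := by
  ext z
  simp only [mem_dom, ZFSet.mem_singleton]
  constructor
  · rintro ⟨u, h⟩
    exact (ZFSet.pair_injective h).1
  · rintro rfl
    exact ⟨b, rfl⟩

theorem good_singleton : Good {ZFSet.pair ∅ ∅} where
  pairs z hz := ⟨∅, by simp [dom_singleton_pair], ∅, by simp [dom_singleton_pair],
    by simpa using hz⟩
  wo := by
    rw [dom_singleton_pair]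
    refine ⟨by simp, by simp, by simp, by simp, fun S hS hne => ?_⟩
    obtain ⟨a, ha⟩ := hne
    have hS : ∀ b ∈ S, b = ∅ := fun b hb => by simpa using hS hb
    exact ⟨a, ha, fun b hb => by simp [hS a ha, hS b hb]⟩
  trans := by
    rw [dom_singleton_pair]
    intro y hy
    simp_all
  nonempty := ⟨∅, by simp [dom_singleton_pair]⟩

/-- `J₂` is the union of the tower over a well-ordering of `J₁`. -/
theorem exists_good_mem_J2 :
    ∃ p, Good p ∧ p ∈ J2 ∧ dom p ⊆ J2 ∧ ∃ n, J1 ∈ level p n := by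
  have hp := good_singleton
  set p : ZFSet.{0} := {ZFSet.pair ∅ ∅} with hpdef
  have hJ1 : RudClosed J1 := (isLeast_rudClosure ∅).1.2.2
  have h0 : ∅ ∈ J1 := (isLeast_rudClosure ∅).1.2.1
  have h12 : J1 ∈ J2 := (isLeast_rudClosure J1).1.2.1
  have h12' : J1 ⊆ J2 := (isLeast_rudClosure J1).1.1
  have hpJ : p ∈ J1 := hJ1.rud1 (F := fun x => {ZFSet.pair x x})
    (.singleton (.opair (.proj 0) (.proj 0))) h0
  have hd : dom p ⊆ J1 := by
    rw [dom_singleton_pair]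
    intro z hz
    rw [ZFSet.mem_singleton.1 hz]
    exact h0
  have hmem : ∀ {z}, z ∈ J1 ↔ ∃ n, z ∈ level p n := hp.mem_rudClosure_iff
    ⟨0, show ∅ ∈ dom p by simp [hpdef, dom_singleton_pair]⟩ hpJ hd
  -- The union of the first tower, an element of `J2`, becomes the base of the second.
  obtain ⟨W, hW, hWeq⟩ := hp.exists_mem_eq_towerUnion hJ1 hpJ hd rudClosed_J2 h12 (h12' hpJ)
  have hmemW : ∀ {z}, z ∈ W ↔ z ∈ towerUnion p := fun {z} => by rw [← hWeq]; rfl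
  have hset : (J1 : Set ZFSet.{0}) = {z | ∃ n, z ∈ level p n} := by
    ext z
    exact hmem
  have hwo : WellOrders (W : Set ZFSet.{0}) (J1 : Set ZFSet.{0}) := by
    rw [hWeq, hset]
    exact hp.wellOrders_towerUnion
  have hpairs : ∀ z ∈ W, ∃ a ∈ J1, ∃ b ∈ J1, z = ZFSet.pair a b := by
    intro z hz
    obtain ⟨n, hn⟩ := hmemW.1 hz
    obtain ⟨a, ha, b, hb, rfl⟩ := (hp.tower n).pairs z hn
    exact ⟨a, hmem.2 ⟨n, ha⟩, b, hmem.2 ⟨n, hb⟩, rfl⟩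
  have hdom : dom W = J1 := by
    ext a
    rw [mem_dom]
    constructor
    · rintro ⟨u, hu⟩
      obtain ⟨a', ha, b', -, e⟩ := hpairs _ hu
      rw [(ZFSet.pair_injective e).1]
      exact ha
    · exact fun ha => ⟨a, hwo.refl a ha⟩
  have hgood : Good W :=
    { pairs := hdom.symm ▸ hpairs
      wo := hdom.symm ▸ hwo
      trans := by
        rw [hdom]
        intro y hy t ht
        obtain ⟨n, hn⟩ := hmem.1 hy
        exact hmem.2 ⟨n, hp.subset_level hn ht⟩
      nonempty := ⟨∅, hdom.symm ▸ h0⟩ }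
  exact ⟨W, hgood, hW, hdom.symm ▸ h12',
    ⟨1, by have := hgood.level_mem_level 0; rwa [show level W 0 = J1 from hdom] at this⟩⟩

theorem isTransitive_J2 : J2.IsTransitive := by
  obtain ⟨p, hp, hpJ, hd, hJ1⟩ := exists_good_mem_J2
  exact hp.isTransitive_J2 hpJ hd hJ1

theorem exists_isUniversalWellOrdering : ∃ W, IsUniversalWellOrdering W := by
  obtain ⟨p, hp, hpJ, hd, hJ1⟩ := exists_good_mem_J2
  exact ⟨_, hp.isUniversalWellOrdering hpJ hd hJ1⟩

/-! ### Quotients -/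

theorem IsIotaClass.exists_inter_prod {E : Set ZFSet.{0}} (hE : IsIotaClass E) {x : ZFSet.{0}}
    (hx : x ∈ J2) : ∃ e ∈ J2, ∀ a b, ZFSet.pair a b ∈ e ↔
      ZFSet.pair a b ∈ E ∧ a ∈ x ∧ b ∈ x := by
  have hprod : (bUnion x fun a => bUnion x fun b => {ZFSet.pair a b}) ∈ J2 :=
    rudClosed_J2.rud1 (F := fun x => bUnion x fun a => bUnion x fun b => {ZFSet.pair a b})
      (.bUnion (.proj 0) (.bUnion (.proj 1) (.singleton (.opair (.proj 1) (.proj 0))))) hx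
  obtain ⟨e, he, h⟩ := hE.2 _ ⟨_, hprod, rfl⟩
  refine ⟨e, he, fun a b => ?_⟩
  rw [← SetLike.mem_coe, h]
  simp only [Set.mem_inter_iff, SetLike.mem_coe, mem_bUnion, ZFSet.mem_singleton]
  refine and_congr_right fun _ => ⟨?_, fun ⟨ha, hb⟩ => ⟨a, ha, b, hb, rfl⟩⟩
  rintro ⟨a', ha, b', hb, e⟩
  obtain ⟨rfl, rfl⟩ := ZFSet.pair_injective e
  exact ⟨ha, hb⟩

theorem isIotaSet_quotient {W X E : Set ZFSet.{0}} (hW : IsIotaClass W) (hE : IsIotaClass E)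
    (hX : IsIotaSet X) : IsIotaSet (quotient W X E) := by
  obtain ⟨x, hx, rfl⟩ := hX
  obtain ⟨e, he, hmem⟩ := hE.exists_inter_prod hx
  obtain ⟨w, hw, hmem'⟩ := hW.exists_inter_prod hx
  -- An element fails to represent its block exactly when it is the left coordinate of a pair in `e`
  -- but not in `w`.
  refine ⟨x \ dom (e \ w), rudClosed_J2.rud3 (B := fun x e w => x \ dom (e \ w))
    (.sdiff (.proj 0) (.dom (.sdiff (.proj 1) (.proj 2)))) hx he hw, ?_⟩
  ext a
  simp only [SetLike.mem_coe, ZFSet.mem_sdiff, mem_dom, quotient, hmem, hmem', Set.mem_ofPred_eq]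
  grind

open Set in
theorem isDefinableSubset_quotient {W X E : Set ZFSet.{0}} (hW : IsDefinableSubset J2 W)
    (hX : IsDefinableSubset J2 X) (hE : IsDefinableSubset J2 E) :
    IsDefinableSubset J2 (quotient W X E) := by
  obtain ⟨W, hW, rfl⟩ := hW
  obtain ⟨X, hX, rfl⟩ := hX
  obtain ⟨E, hE, rfl⟩ := hE
  have hpair : Rudimentary (fun v : Fin 2 → ZFSet.{0} => ZFSet.pair (v 0) (v 1)) :=
    .opair (.proj 0) (.proj 1)
  let q : J2 → J2 → J2 := fun a b => lift rudClosed_J2 hpair ![a, b]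
  have hq : ∀ a b, (q a b : ZFSet.{0}) = ZFSet.pair a b := fun a b => rfl
  have key : ∀ {S : Set J2}, (univ : Set J2).Definable₁ setLanguage S →
      (univ : Set J2).Definable setLanguage
        {w : Option (Fin 1) → J2 | q (w (some 0)) (w none) ∈ S} := by
    intro S hS
    refine Definable.preimage_map (F := fun w : Option (Fin 1) → J2 => ![q (w (some 0)) (w none)])
      (fun i => ?_) hS
    have : (univ : Set J2).DefinableFun setLanguage
        (fun w : Option (Fin 1) → J2 => q (w (some 0)) (w none)) := by
      refine DefinableFun.comp (fun i => ?_)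
        (definableFun_lift rudClosed_J2 isTransitive_J2 hpair)
      fin_cases i
      · exact .proj _
      · exact .proj _
    fin_cases i
    exact this
  have hXn : (univ : Set J2).Definable setLanguage {w : Option (Fin 1) → J2 | w none ∈ X} :=
    hX.preimage_comp (fun _ => none)
  refine ⟨{a | a ∈ X ∧ ∀ b, b ∈ X ∧ q a b ∈ E → q a b ∈ W}, ?_, ?_⟩
  · exact Definable.inter hX (definable_all (α := Fin 1)
      (P := fun v b => b ∈ X ∧ q (v 0) b ∈ E → q (v 0) b ∈ W)
      (definable_imp (hXn.inter (key hE)) (key hW)))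
  · have hS : ∀ (S : Set J2) (a b : J2), ZFSet.pair (a : ZFSet.{0}) b ∈ Subtype.val '' S ↔
        q a b ∈ S := by
      intro S a b
      rw [← hq, Subtype.val_injective.mem_set_image]
    ext a
    simp only [quotient, Set.mem_ofPred_eq]
    constructor
    · rintro ⟨⟨a, ha, rfl⟩, h⟩
      exact ⟨a, ⟨ha, fun b hb => (hS W a b).1 (h b ⟨⟨b, hb.1, rfl⟩, (hS E a b).2 hb.2⟩)⟩, rfl⟩
    · rintro ⟨a, ⟨ha, h⟩, rfl⟩
      refine ⟨⟨a, ha, rfl⟩, ?_⟩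
      rintro _ ⟨⟨b, hb, rfl⟩, hE⟩
      exact (hS W a b).2 (h b ⟨hb, (hS E a b).1 hE⟩)

theorem IsDefinableSubset.subset {x : ZFSet.{0}} {X : Set ZFSet.{0}} (hX : IsDefinableSubset x X) :
    X ⊆ x := by
  obtain ⟨S, -, rfl⟩ := hX
  rintro _ ⟨a, -, rfl⟩
  exact a.2

theorem IsIotaSet.inter {X Y : Set ZFSet.{0}} (hX : IsIotaSet X) (hY : IsIotaSet Y) :
    IsIotaSet (X ∩ Y) := by
  obtain ⟨x, hx, rfl⟩ := hX
  obtain ⟨y, hy, rfl⟩ := hY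
  exact ⟨x ∩ y, rudClosed_J2.rud3 (B := fun x y _ => x ∩ y) (.inf (.proj 0) (.proj 1)) hx hy hy,
    by ext; simp⟩

theorem isIotaClass_quotient {W X E : Set ZFSet.{0}} (hW : IsUniversalWellOrdering W)
    (hX : IsIotaClass X) (hE : IsIotaClass E) : IsIotaClass (quotient W X E) := by
  refine ⟨isDefinableSubset_quotient hW.iotaRelation.1.1 hX.1 hE.1, fun Y hY => ?_⟩
  obtain ⟨S, hS, hYS⟩ := hW.exists_initialSegment Y hY
  have hq := isIotaSet_quotient hW.iotaRelation.1 hE (hX.2 S (hW.initialSegment_isIotaSet S hS))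
  have : quotient W X E ∩ Y = quotient W (X ∩ S) E ∩ Y := by
    ext a
    simp only [quotient, Set.mem_inter_iff, Set.mem_ofPred_eq]
    refine and_congr_left fun haY => ?_
    have haS := hYS haY
    constructor
    · rintro ⟨ha, h⟩
      exact ⟨⟨ha, haS⟩, fun b hb => h b ⟨hb.1.1, hb.2⟩⟩
    · rintro ⟨⟨ha, -⟩, h⟩
      refine ⟨ha, fun b ⟨hb, hab⟩ => ?_⟩
      have haJ := hX.1.subset ha
      have hbJ := hX.1.subset hb
      rcases hW.wellOrders.total a haJ b hbJ with hle | hle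
      · exact hle
      -- A competitor `b` preceding `a` lies in `S`, so the truncated quotient has already taken it
      -- into account.
      · exact h b ⟨⟨hb, hS.2 a haS b hbJ hle⟩, hab⟩
  rw [this]
  exact hq.inter hY

end AnalysisJ2

/-- A universal well-ordering of `J₂` exists and, whichever one is used to pick representatives,
quotients of `ι`-sets are `ι`-sets and quotients of `ι`-classes are `ι`-classes. -/
theorem proposition2p14 :
    (∃ W : Set ZFSet.{0}, AnalysisJ2.IsUniversalWellOrdering W) ∧
    ∀ W : Set ZFSet.{0}, AnalysisJ2.IsUniversalWellOrdering W →
      (∀ X E : Set ZFSet.{0}, AnalysisJ2.IsIotaSet X →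
        AnalysisJ2.IsEquivalenceIotaRelation E X →
        AnalysisJ2.IsIotaSet (AnalysisJ2.quotient W X E)) ∧
      (∀ X E : Set ZFSet.{0}, AnalysisJ2.IsIotaClass X →
        AnalysisJ2.IsEquivalenceIotaRelation E X →
        AnalysisJ2.IsIotaClass (AnalysisJ2.quotient W X E)) :=
  ⟨AnalysisJ2.exists_isUniversalWellOrdering, fun _ hW =>
    ⟨fun _ _ hX hE => AnalysisJ2.isIotaSet_quotient hW.iotaRelation.1 hE.iotaRelation.1 hX,
      fun _ _ hX hE => AnalysisJ2.isIotaClass_quotient hW hX hE.iotaRelation.1⟩⟩
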